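/- Theorem 3. Let $0<\delta\le 1/4$, and let $\omega$ be an exponent such that two $k\times k$ matrices of words can be multiplied in $O(k^{\omega})$ time (on a word RAM whose word size is at least a constant times $\log k$). For a graph $G$ let $n$, $m$ and $t$ be its numbers of vertices, edges and triangles. Let $c_1,c_2>0$ be arbitrary constants and consider the graphs $G$ with $n\ge 1$, $m\ge c_1 n^{1+3.82\delta}$ and $t\ge c_2 m^{1+\delta}$. (a) Let $U$ be a random vertex set that contains each vertex of $G$ independently with probability $n^{-\delta}$, and let $Z$ be the number of triangles of the induced subgraph $G[U]$. There is a constant $C$, which depends only on $\delta,c_1,c_2$, such that for every such $G$ and every $0<\varepsilon\le 1/2$, $$(1-\varepsilon)t\le Z\,n^{3\delta}\le(1+\varepsilon)t \quad\text{with probability at least } 1-C\varepsilon^{-2}n^{-3.82\delta^2}.$$ (b) For each of the two time bounds $$T(n,m)=n^{\omega(1-\delta)}\qquad\text{and}\qquad T(n,m)=\left(mn^{-2\delta}\right)^{2\omega/(\omega+1)}$$ there are a randomized word-RAM algorithm and a constant $\gamma>0$, which depend on $\delta$ and $\omega$ but not on $\varepsilon,c_1,c_2$, and a constant $C$, which depends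 on these and on $c_1,c_2$ but not on $\varepsilon$, such that on every such $G$, given by its adjacency matrix and its adjacency lists, and for every word size at least a constant (depending on the algorithm) times $\log(n+2)$, the algorithm has expected running time at most $C\cdot T(n,m)$, and for every $0<\varepsilon\le 1/2$, with probability at least $1-C\varepsilon^{-2}n^{-\gamma}$, it outputs both (i) an estimate of $t$ in the interval $[(1-\varepsilon)t,(1+\varepsilon)t]$, and (ii) a triangle of $G$. In particular, for each fixed $\varepsilon$ the algorithm succeeds with high probability (the failure probability tends to $0$ as $n\to\infty$), and since $\varepsilon^{-2}\ge 1$, the expected time for (i) is also at most $C\varepsilon^{-2}T(n,m)$. -/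

import Mathlib

open MeasureTheory
open scoped ENNReal

/-! A randomized word RAM.  Memory consists of registers and of arrays, both named by natural
numbers, and every cell holds a word, that is, a number below `2 ^ w`.  A program is a finite
piece of syntax, so it names only finitely many registers and arrays. -/

namespace WordRAM

/-- Binary operations on words; results are reduced modulo `2 ^ w`. -/
inductive BinOp
  | add | sub | mul | div | mod | and | or | xor | shl | shr | lt | eq

/-- Value of an operation on words (`sub` is truncated, division by `0` gives `0`). -/
def BinOp.eval (w : ℕ) (o : BinOp) (y z : ℕ) : ℕ :=
  (match o with
    | .add => y + z
    | .sub => y - z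
    | .mul => y * z
    | .div => y / z
    | .mod => y % z
    | .and => y &&& z
    | .or => y ||| z
    | .xor => y ^^^ z
    | .shl => y <<< z
    | .shr => y >>> z
    | .lt => if y < z then 1 else 0
    | .eq => if y = z then 1 else 0) % 2 ^ w

/-- Programs.  The letters `x`, `y`, `z`, `i` name registers and `a` names an array. -/
inductive Cmd
  /-- do nothing -/
  | skip
  /-- `x := k mod 2 ^ w` -/
  | const (x k : ℕ)
  /-- `x := y o z` -/
  | op (o : BinOp) (x y z : ℕ)
  /-- `x := a[i]` -/
  | load (x a i : ℕ)
  /-- `a[i] := x` -/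
  | store (a i x : ℕ)
  /-- `x :=` a fresh uniformly random word -/
  | rand (x : ℕ)
  /-- `c; d` -/
  | seq (c d : Cmd)
  /-- `if x ≠ 0 then c else d` -/
  | branch (x : ℕ) (c d : Cmd)
  /-- `while x ≠ 0 do c` -/
  | loop (x : ℕ) (c : Cmd)

/-- Contents of the memory: `reg x` is register `x` and `arr a i` is entry `i` of array `a`. -/
structure Memory where
  reg : ℕ → ℕ
  arr : ℕ → ℕ → ℕ

/-- `x := v` -/
def Memory.setReg (s : Memory) (x v : ℕ) : Memory :=
  { s with reg := Function.update s.reg x v }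

/-- `a[i] := v` -/
def Memory.setArr (s : Memory) (a i v : ℕ) : Memory :=
  { s with arr := Function.update s.arr a (Function.update (s.arr a) i v) }

/-- A configuration: the commands still to be executed (the machine has halted when there are
none), the memory, and the number of random words consumed so far. -/
structure Config where
  todo : List Cmd
  mem : Memory
  pos : ℕ

/-- One step of the machine with word size `w` and random words `τ 0, τ 1, …`. -/
def step (w : ℕ) (τ : ℕ → Fin (2 ^ w)) (K : Config) : Config :=
  match K.todo with
  | [] => K
  | .skip :: l => { K with todo := l }
  | .const x k :: l => { K with todo := l, mem := K.mem.setReg x (k % 2 ^ w) }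
  | .op o x y z :: l =>
      { K with todo := l, mem := K.mem.setReg x (o.eval w (K.mem.reg y) (K.mem.reg z)) }
  | .load x a i :: l =>
      { K with todo := l, mem := K.mem.setReg x (K.mem.arr a (K.mem.reg i)) }
  | .store a i x :: l =>
      { K with todo := l, mem := K.mem.setArr a (K.mem.reg i) (K.mem.reg x) }
  | .rand x :: l =>
      { todo := l, mem := K.mem.setReg x (τ K.pos : ℕ), pos := K.pos + 1 }
  | .seq c d :: l => { K with todo := c :: d :: l }
  | .branch x c d :: l => { K with todo := (if K.mem.reg x ≠ 0 then c else d) :: l }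
  | .loop x c :: l => { K with todo := if K.mem.reg x ≠ 0 then c :: .loop x c :: l else l }

/-- The configuration after `i` steps of program `P` started on memory `s`. -/
def run (w : ℕ) (P : Cmd) (s : Memory) (τ : ℕ → Fin (2 ^ w)) (i : ℕ) : Config :=
  (step w τ)^[i] ⟨[P], s, 0⟩

/-- `P` halts on `s` with a final memory that satisfies `Q`. -/
def HaltsWith (w : ℕ) (P : Cmd) (s : Memory) (τ : ℕ → Fin (2 ^ w)) (Q : Memory → Prop) : Prop :=
  ∃ i, (run w P s τ i).todo = [] ∧ Q (run w P s τ i).mem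

/-- The number of steps until `P` halts (`∞` if it never does). -/
noncomputable def haltTime (w : ℕ) (P : Cmd) (s : Memory) (τ : ℕ → Fin (2 ^ w)) : ℝ≥0∞ :=
  ⨅ (i : ℕ) (_ : (run w P s τ i).todo = []), (i : ℝ≥0∞)

/-- The law of a sequence of independent uniformly random words. -/
noncomputable def tapeMeasure (w : ℕ) : Measure (ℕ → Fin (2 ^ w)) :=
  Measure.infinitePi fun _ : ℕ => (PMF.uniformOfFintype (Fin (2 ^ w))).toMeasure

/-- The probability that `P` halts on `s` with a final memory that satisfies `Q`. -/
noncomputable def successProb (w : ℕ) (P : Cmd) (s : Memory) (Q : Memory → Prop) : ℝ :=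
  (tapeMeasure w).real {τ | HaltsWith w P s τ Q}

/-- The expected number of steps of `P` on `s`. -/
noncomputable def expectedTime (w : ℕ) (P : Cmd) (s : Memory) : ℝ≥0∞ :=
  ∫⁻ τ, haltTime w P s τ ∂(tapeMeasure w)

/-- Input of matrix multiplication over the ring of words: register `0` holds `k`, arrays `0` and
`1` hold `A` and `B` row by row, and everything else is `0`. -/
def matInput {k w : ℕ} (A B : Matrix (Fin k) (Fin k) (ZMod (2 ^ w))) : Memory where
  reg x := if x = 0 then k else 0
  arr a p :=
    if h : p / k < k then
      if h' : p % k < k then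
        if a = 0 then (A ⟨p / k, h⟩ ⟨p % k, h'⟩).val
        else if a = 1 then (B ⟨p / k, h⟩ ⟨p % k, h'⟩).val
        else 0
      else 0
    else 0

/-- Two `k × k` matrices of words can be multiplied in `O(k ^ ω)` steps, for every word size
`w ≥ κ log₂ (k + 2)`, where `κ` is some constant.  The product is to be left in array `2`. -/
def MatMulInTime (ω : ℝ) : Prop :=
  ∃ (P : Cmd) (κ : ℕ) (C : ℝ), ∀ k : ℕ, 1 ≤ k → ∀ w : ℕ, (k + 2) ^ κ ≤ 2 ^ w →
    ∀ (A B : Matrix (Fin k) (Fin k) (ZMod (2 ^ w))) (τ : ℕ → Fin (2 ^ w)),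
      ∃ i : ℕ, (i : ℝ) ≤ C * (k : ℝ) ^ ω ∧ (run w P (matInput A B) τ i).todo = [] ∧
        ∀ a b : Fin k, (run w P (matInput A B) τ i).mem.arr 2 (a * k + b) = ((A * B) a b).val

/-- Input of graph algorithms on the vertex set `{0, …, n - 1}`: register `0` holds `n`, array `0`
holds the adjacency matrix row by row, entry `u` of array `1` is the degree of `u`, and entries
`u * n + i`, `i < deg u`, of array `2` list the neighbours of `u` in the order given by `nbr`.
Everything else is `0`. -/
def graphInput {n : ℕ} (G : SimpleGraph (Fin n)) [DecidableRel G.Adj]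
    (nbr : (u : Fin n) → Fin (G.degree u) ≃ G.neighborSet u) : Memory where
  reg x := if x = 0 then n else 0
  arr a p :=
    if a = 0 then
      if h : p / n < n then
        if h' : p % n < n then
          if G.Adj ⟨p / n, h⟩ ⟨p % n, h'⟩ then 1 else 0
        else 0
      else 0
    else if a = 1 then
      if h : p < n then G.degree ⟨p, h⟩ else 0
    else if a = 2 then
      if h : p / n < n then
        if h' : p % n < G.degree ⟨p / n, h⟩ then (nbr ⟨p / n, h⟩ ⟨p % n, h'⟩ : Fin n) else 0
      else 0
    else 0

end WordRAM

/-- Number of edges. -/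
def numEdges {n : ℕ} (G : SimpleGraph (Fin n)) [DecidableRel G.Adj] : ℕ := G.edgeFinset.card

/-- Number of triangles. -/
def numTriangles {n : ℕ} (G : SimpleGraph (Fin n)) [DecidableRel G.Adj] : ℕ :=
  (G.cliqueFinset 3).card

/-- Number of triangles of the subgraph induced by `U`. -/
def numTrianglesIn {n : ℕ} (G : SimpleGraph (Fin n)) [DecidableRel G.Adj]
    (U : Finset (Fin n)) : ℕ :=
  ((G.cliqueFinset 3).filter fun T => T ⊆ U).card

open Classical in
/-- Probability that a random vertex set, which keeps every vertex independently with
probability `p`, satisfies `Q`. -/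
noncomputable def sampleProb (n : ℕ) (p : ℝ) (Q : Finset (Fin n) → Prop) : ℝ :=
  ∑ U : Finset (Fin n) with Q U, p ^ U.card * (1 - p) ^ (n - U.card)

/-- The output required of the algorithm: register `0` holds an estimate of the number of triangles
with relative error at most `ε`, and registers `1`, `2`, `3` hold the vertices of a triangle. -/
def GoodOutput {n : ℕ} (G : SimpleGraph (Fin n)) [DecidableRel G.Adj] (ε : ℝ)
    (s : WordRAM.Memory) : Prop :=
  ((s.reg 0 : ℝ) ∈
    Set.Icc ((1 - ε) * (numTriangles G : ℝ)) ((1 + ε) * (numTriangles G : ℝ))) ∧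
  ∃ u v x : Fin n, s.reg 1 = u ∧ s.reg 2 = v ∧ s.reg 3 = x ∧ G.Adj u v ∧ G.Adj v x ∧ G.Adj u x

/-! Both parts rest on Chebyshev's inequality.

In the vertex-sampling estimator a triple of vertices survives with probability `p ^ 3`, and the
variance of the number `Z` of surviving triangles is a sum over pairs of triangles that share a
vertex (`sum_weight_sq`).  A vertex lies in at most `m` triangles and an edge in at most `n`, so the
variance is at most `t (3 m p ^ 5 + 3 n p ^ 4 + p ^ 3)` (`sum_pow_card_union_le`).  For
`p = n ^ (-δ)` the first term dominates and the relative variance is of order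
`n ^ δ * m / t ≤ n ^ δ * m ^ (-δ)`, up to constants, which is at most `n ^ (-3.82 δ ^ 2)`
(`sampleProb_ge`).

For the algorithm it is not necessary to multiply matrices: under the hypothesis `t ≥ c₂ m ^ (1 + δ)`
a random pair of an edge `u v` and a vertex `x` is a triangle with probability `3 t / (m n)`, which
is of order at least `m ^ δ / n`, so already about `n` such pairs contain many triangles, and they
can be tested in constant time each.  The pairs are drawn in strata.  With `L` the least power of two
for which `n L ≥ 2 m` and `N` the least power of two that is at least `n`, the adjacency list
of every vertex `u` is cut into blocks of length `L`, and for each block one random word selects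
a position in the block, hence possibly a neighbour `v`, and a number `x < N`.  The trial succeeds
if `u < v < x < n` is a triangle.  There are at most `n + 2 m / L ≤ 2 n` trials (`firstTrial_le`).
Since `L N` divides the number of words, every triangle is found with probability exactly
`1 / (L N)` (`sum_hit`, `sum_graphInput_eq`), so the number of successes times `L N` is an unbiased
integral estimate of `t`; the trials use different random words, so the variance of the number of
successes is at most its mean and the failure probability is at most
`L N / (ε ^ 2 t) = O(m / (ε ^ 2 t))`, which is `O(ε ^ (-2) n ^ (-δ))` (`mainProg_successProb`).
If the estimate is accurate then some trial has succeeded, and that trial provides the triangle.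

The program takes at most `300 n` steps on every tape (`mainProg_graph`).  This is within both time
bounds because `ω ≥ 2`: a machine that multiplies `k × k` matrices has to write `k ^ 2` nonzero
cells, one per step (`MatMulInTime.two_le`).  Hence `ω (1 - δ) ≥ 1` and `2 ω / (ω + 1) ≥ 1`, while
`m n ^ (-2 δ)` is at least of order `n` (`linear_le_time`). -/

/-! ### Big-step semantics of the machine -/

namespace WordRAM

/-- Started with `c` on top of the stack, memory `s` and `p` random words consumed, the machine
pops `c` within `B` steps, with memory `s'` and `p'` random words consumed. -/
def Reaches (w : ℕ) (τ : ℕ → Fin (2 ^ w)) (c : Cmd) (s : Memory) (p B : ℕ) (s' : Memory)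
    (p' : ℕ) : Prop :=
  ∃ k ≤ B, ∀ l, (step w τ)^[k] ⟨c :: l, s, p⟩ = ⟨l, s', p'⟩

section Semantics

variable {w : ℕ} {τ : ℕ → Fin (2 ^ w)}

theorem Reaches.mono {c : Cmd} {s s' : Memory} {p p' B B' : ℕ}
    (h : Reaches w τ c s p B s' p') (hB : B ≤ B') : Reaches w τ c s p B' s' p' := by
  obtain ⟨k, hk, h⟩ := h
  exact ⟨k, hk.trans hB, h⟩

theorem Reaches.of_step {c : Cmd} {s s' : Memory} {p p' : ℕ}
    (h : ∀ l, step w τ ⟨c :: l, s, p⟩ = ⟨l, s', p'⟩) : Reaches w τ c s p 1 s' p' :=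
  ⟨1, le_rfl, h⟩

theorem Reaches.seq {c d : Cmd} {s s₁ s₂ : Memory} {p p₁ p₂ B₁ B₂ : ℕ}
    (h₁ : Reaches w τ c s p B₁ s₁ p₁) (h₂ : Reaches w τ d s₁ p₁ B₂ s₂ p₂) :
    Reaches w τ (.seq c d) s p (B₁ + B₂ + 1) s₂ p₂ := by
  obtain ⟨k₁, hk₁, h₁⟩ := h₁
  obtain ⟨k₂, hk₂, h₂⟩ := h₂
  refine ⟨k₂ + k₁ + 1, by omega, fun l => ?_⟩
  rw [Function.iterate_succ_apply, Function.iterate_add_apply]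
  change (step w τ)^[k₂] ((step w τ)^[k₁] ⟨c :: d :: l, s, p⟩) = _
  rw [h₁, h₂]

/-- The effect of a loop-free program on the memory and on the number of random words consumed. -/
def Cmd.exec (w : ℕ) (τ : ℕ → Fin (2 ^ w)) : Cmd → Memory → ℕ → Memory × ℕ
  | .skip, s, p => (s, p)
  | .const x k, s, p => (s.setReg x (k % 2 ^ w), p)
  | .op o x y z, s, p => (s.setReg x (o.eval w (s.reg y) (s.reg z)), p)
  | .load x a i, s, p => (s.setReg x (s.arr a (s.reg i)), p)
  | .store a i x, s, p => (s.setArr a (s.reg i) (s.reg x), p)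
  | .rand x, s, p => (s.setReg x (τ p : ℕ), p + 1)
  | .seq c d, s, p => d.exec w τ (c.exec w τ s p).1 (c.exec w τ s p).2
  | .branch x c d, s, p => if s.reg x ≠ 0 then c.exec w τ s p else d.exec w τ s p
  | .loop _ _, s, p => (s, p)

/-- A bound on the number of steps of a loop-free program. -/
def Cmd.cost : Cmd → ℕ
  | .seq c d => c.cost + d.cost + 1
  | .branch _ c d => max c.cost d.cost + 1
  | _ => 1

/-- The program contains no `loop`. -/
def Cmd.LoopFree : Cmd → Prop
  | .seq c d => c.LoopFree ∧ d.LoopFree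
  | .branch _ c d => c.LoopFree ∧ d.LoopFree
  | .loop _ _ => False
  | _ => True

/-- `Cmd.exec` agrees with the step semantics, within `Cmd.cost` steps. -/
theorem reaches_exec (c : Cmd) (hc : c.LoopFree) (s : Memory) (p : ℕ) :
    Reaches w τ c s p c.cost (c.exec w τ s p).1 (c.exec w τ s p).2 := by
  induction c generalizing s p with
  | seq c d ihc ihd => exact (ihc hc.1 s p).seq (ihd hc.2 _ _)
  | branch x c d ihc ihd =>
    simp only [Cmd.exec, Cmd.cost]
    by_cases hx : s.reg x ≠ 0
    · obtain ⟨k, hk, h⟩ := ihc hc.1 s p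
      refine ⟨k + 1, by omega, fun l => ?_⟩
      rw [Function.iterate_succ_apply]
      simpa [step, hx] using h l
    · obtain ⟨k, hk, h⟩ := ihd hc.2 s p
      refine ⟨k + 1, by omega, fun l => ?_⟩
      rw [Function.iterate_succ_apply]
      simpa [step, hx] using h l
  | loop x c => exact hc.elim
  | _ => exact Reaches.of_step fun l => rfl

/-- A loop whose body leads from the invariant `I j` to `I (j + 1)` within `B j` steps, and which
stops exactly when `I K` is reached. -/
theorem reaches_loop {x : ℕ} {c : Cmd} (I : ℕ → Memory → ℕ → Prop) (B : ℕ → ℕ) (K : ℕ)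
    (hstep : ∀ j < K, ∀ s p, I j s p → s.reg x ≠ 0 ∧
      ∃ s' p', Reaches w τ c s p (B j) s' p' ∧ I (j + 1) s' p')
    (hK : ∀ s p, I K s p → s.reg x = 0) (s : Memory) (p : ℕ) (h0 : I 0 s p) :
    ∃ s' p', Reaches w τ (.loop x c) s p (∑ j ∈ Finset.range K, (B j + 1) + 1) s' p' ∧
      I K s' p' := by
  induction K generalizing I B s p with
  | zero =>
    refine ⟨s, p, ⟨1, by simp, fun l => ?_⟩, h0⟩
    simp [step, hK s p h0]
  | succ K ih =>
    obtain ⟨hx, s₁, p₁, ⟨k₁, hk₁, hr⟩, h1⟩ := hstep 0 (by omega) s p h0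
    obtain ⟨s', p', ⟨k₂, hk₂, hr'⟩, h'⟩ := ih (fun j => I (j + 1)) (fun j => B (j + 1))
      (fun j hj => hstep (j + 1) (by omega)) hK s₁ p₁ h1
    refine ⟨s', p', ⟨k₂ + k₁ + 1, ?_, fun l => ?_⟩, h'⟩
    · rw [Finset.sum_range_succ']
      omega
    · rw [Function.iterate_succ_apply, Function.iterate_add_apply]
      have : step w τ ⟨.loop x c :: l, s, p⟩ = ⟨c :: .loop x c :: l, s, p⟩ := by simp [step, hx]
      rw [this, hr, hr']

end Semantics

/-- Sequential composition of a list of commands. -/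
def Cmd.block : List Cmd → Cmd
  | [] => .skip
  | c :: l => .seq c (Cmd.block l)

/-! ### A single trial -/

/-- Computes the sum of the entries `0, …, n - 1` of array `1` in register `4`; register `0`
holds `n` and register `18` holds `1`. -/
def sumProg : Cmd :=
  .seq (.op .lt 8 7 0) (.loop 8 (Cmd.block
    [.load 9 1 7, .op .add 4 4 9, .op .add 7 7 18, .op .lt 8 7 0]))

/-- Computes in register `x` the least power `2 ^ ℓ` for which `2 ^ ℓ` times register `y` is at
least register `a`. -/
def powProg (x y a : ℕ) : Cmd :=
  .seq (Cmd.block [.const x 1, .op .mul 9 x y, .op .lt 8 9 a])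
    (.loop 8 (Cmd.block [.op .add x x x, .op .mul 9 x y, .op .lt 8 9 a]))

/-- Draws a word `r` and computes `i = j + r % L`, `x = r / L % N`, the neighbour `v` number `i` of
`u`, and the entry `(u, x)` of the adjacency matrix in the registers `15`, `14`, `13`, `16`.  Here
`u`, `j`, `L`, `N` are in the registers `7`, `10`, `5`, `6`. -/
def drawProg : Cmd := Cmd.block
  [.rand 12, .op .mod 15 12 5, .op .add 15 10 15, .op .div 14 12 5, .op .mod 14 14 6,
   .op .mul 13 7 0, .op .add 16 13 14, .load 16 0 16, .op .add 13 13 15, .load 13 2 13]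

/-- Sets register `16` to `0` unless register `a` is below register `b`. -/
def guardProg (a b : ℕ) : Cmd := .seq (.op .lt 19 a b) (.op .mul 16 16 19)

/-- Multiplies register `16` by the entry `(v, x)` of the adjacency matrix. -/
def lookupProg : Cmd := Cmd.block
  [.op .mul 19 13 0, .op .add 19 19 14, .load 19 0 19, .op .mul 16 16 19]

/-- Sets register `16` to `0` unless `i` is below the degree of `u` and `u < v < x < n` is a
triangle. -/
def testProg : Cmd :=
  .seq (guardProg 15 9) (.seq (guardProg 7 13) (.seq (guardProg 13 14)
    (.seq (guardProg 14 0) lookupProg)))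

/-- Adds register `16` to the counter in register `11`, copies the triangle found, if any, to the
registers `1`, `2`, `3`, and increases `j` by `L`. -/
def recordProg : Cmd := Cmd.block
  [.op .add 11 11 16,
   .branch 16 (Cmd.block [.op .mul 1 7 18, .op .mul 2 13 18, .op .mul 3 14 18]) .skip,
   .op .add 10 10 5, .op .lt 17 10 9]

/-- One trial: a random pair of a neighbour `v` of `u`, taken from the block of the neighbours
number `j, …, j + L - 1`, and a vertex `x` is tested for being a triangle. -/
def trialProg : Cmd := .seq drawProg (.seq testProg recordProg)

/-- The result of a trial that draws the word `r`, as a number in `{0, 1}`. -/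
def hit (arr : ℕ → ℕ → ℕ) (n L N u j r : ℕ) : ℕ :=
  if j + r % L < arr 1 u ∧ u < arr 2 (u * n + (j + r % L)) ∧
      arr 2 (u * n + (j + r % L)) < r / L % N ∧ r / L % N < n ∧
      arr 0 (u * n + r / L % N) = 1 ∧ arr 0 (arr 2 (u * n + (j + r % L)) * n + r / L % N) = 1
  then 1 else 0

theorem hit_le_one (arr : ℕ → ℕ → ℕ) (n L N u j r : ℕ) : hit arr n L N u j r ≤ 1 := by
  unfold hit
  split_ifs <;> omega

/-- The bounds on the input arrays and on the word size that rule out overflows. -/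
structure Tame (w : ℕ) (arr : ℕ → ℕ → ℕ) (n : ℕ) : Prop where
  pos : 1 ≤ n
  matrix : ∀ p, arr 0 p ≤ 1
  degree : ∀ p, arr 1 p ≤ n
  list : ∀ p, arr 2 p < n
  word : (n + 2) ^ 6 ≤ 2 ^ w

theorem Tame.cube {w n : ℕ} {arr : ℕ → ℕ → ℕ} (h : Tame w arr n) :
    8 * (n + 2) ^ 3 ≤ 2 ^ w := by
  have h1 := h.word
  have h2 : 2 ^ 3 ≤ (n + 2) ^ 3 := Nat.pow_le_pow_left (by omega) 3
  have : (n + 2) ^ 6 = (n + 2) ^ 3 * (n + 2) ^ 3 := by ring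
  nlinarith

theorem Tame.square {w n : ℕ} {arr : ℕ → ℕ → ℕ} (h : Tame w arr n) :
    8 * n ^ 2 + 32 * n + 2 ≤ 2 ^ w := by
  nlinarith [sq_nonneg n, pow_pos (show 0 < n from h.pos) 3, h.cube]

theorem ite_mod_of_one {k : ℕ} (hk : 1 % k = 1) (c : Prop) [Decidable c] :
    (if c then 1 else 0) % k = if c then 1 else 0 := by
  split_ifs <;> simp [hk]

section Prog

variable {w : ℕ} {τ : ℕ → Fin (2 ^ w)}

theorem drawProg_spec {s : Memory} {p n L N u j : ℕ} (ht : Tame w s.arr n)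
    (h0 : s.reg 0 = n) (h5 : s.reg 5 = L) (h6 : s.reg 6 = N) (h7 : s.reg 7 = u)
    (h10 : s.reg 10 = j) (hL0 : 0 < L) (hN0 : 0 < N) (hL : L ≤ 2 * n) (hN : N ≤ 2 * n)
    (hu : u < n) (hj : j < n) :
    ∃ s', Reaches w τ drawProg s p 22 s' (p + 1) ∧ s'.arr = s.arr ∧
      s'.reg 15 = j + (τ p : ℕ) % L ∧ s'.reg 14 = (τ p : ℕ) / L % N ∧
      s'.reg 13 = s.arr 2 (u * n + (j + (τ p : ℕ) % L)) ∧
      s'.reg 16 = s.arr 0 (u * n + (τ p : ℕ) / L % N) ∧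
      ∀ r ∉ [12, 13, 14, 15, 16], s'.reg r = s.reg r := by
  have hr := (τ p).isLt
  generalize hrr : ((τ p : ℕ)) = r at hr
  have hW := ht.cube
  have hn := ht.pos
  have hW' := ht.square
  have hiL : r % L < L := Nat.mod_lt _ hL0
  have hxN : r / L % N < N := Nat.mod_lt _ hN0
  have hun : u * n ≤ n ^ 2 := by nlinarith
  have e1 : r % L % 2 ^ w = r % L := Nat.mod_eq_of_lt (by omega)
  have e2 : (j + r % L) % 2 ^ w = j + r % L := Nat.mod_eq_of_lt (by omega)
  have e3 : r / L % 2 ^ w = r / L := Nat.mod_eq_of_lt ((Nat.div_le_self _ _).trans_lt hr)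
  have e4 : r / L % N % 2 ^ w = r / L % N := Nat.mod_eq_of_lt (by omega)
  have e5 : u * n % 2 ^ w = u * n := Nat.mod_eq_of_lt (by omega)
  have e6 : (u * n + r / L % N) % 2 ^ w = u * n + r / L % N := Nat.mod_eq_of_lt (by omega)
  have e7 : (u * n + (j + r % L)) % 2 ^ w = u * n + (j + r % L) := Nat.mod_eq_of_lt (by omega)
  refine ⟨_, (reaches_exec drawProg ?_ s p).mono ?_, ?_⟩
  · simp [drawProg, Cmd.block, Cmd.LoopFree]
  · simp [drawProg, Cmd.block, Cmd.cost]
  · simp +contextual [drawProg, Cmd.block, Cmd.exec, Memory.setReg, BinOp.eval,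
      hrr, h0, h5, h6, h7, h10, e1, e2, e3, e4, e5, e6, e7]

theorem guardProg_spec {s : Memory} (p : ℕ) {a b : ℕ} (hw : 1 ≤ w) (h16 : s.reg 16 ≤ 1) :
    ∃ s', Reaches w τ (guardProg a b) s p 3 s' p ∧ s'.arr = s.arr ∧
      s'.reg 16 = (if s.reg a < s.reg b then s.reg 16 else 0) ∧
      ∀ r ∉ [16, 19], s'.reg r = s.reg r := by
  have hW : 2 ^ 1 ≤ 2 ^ w := Nat.pow_le_pow_right (by omega) hw
  have e1 : (1 : ℕ) % 2 ^ w = 1 := Nat.mod_eq_of_lt (by omega)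
  have e2 : s.reg 16 % 2 ^ w = s.reg 16 := Nat.mod_eq_of_lt (by omega)
  refine ⟨_, (reaches_exec (guardProg a b) ⟨trivial, trivial⟩ s p).mono le_rfl, rfl, ?_, ?_⟩
  · by_cases h : s.reg a < s.reg b <;>
      simp [guardProg, Cmd.exec, Memory.setReg, BinOp.eval, h, e1, e2]
  · simp +contextual [guardProg, Cmd.exec, Memory.setReg]

theorem lookupProg_spec {s : Memory} (p : ℕ) {n v x : ℕ} (ht : Tame w s.arr n)
    (h0 : s.reg 0 = n) (h13 : s.reg 13 = v) (h14 : s.reg 14 = x) (h16 : s.reg 16 ≤ 1)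
    (hv : v < n) (hx : x ≤ 2 * n) :
    ∃ s', Reaches w τ lookupProg s p 9 s' p ∧ s'.arr = s.arr ∧
      s'.reg 16 = s.reg 16 * s.arr 0 (v * n + x) ∧
      ∀ r ∉ [16, 19], s'.reg r = s.reg r := by
  have hW := ht.cube
  have hn := ht.pos
  have hW' := ht.square
  have hvn' : v * n ≤ n ^ 2 := by nlinarith
  have e1 : v * n % 2 ^ w = v * n := Nat.mod_eq_of_lt (by omega)
  have e2 : (v * n + x) % 2 ^ w = v * n + x := Nat.mod_eq_of_lt (by omega)
  have hB := Nat.mul_le_mul h16 (ht.matrix (v * n + x))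
  have e3 : s.reg 16 * s.arr 0 (v * n + x) % 2 ^ w = s.reg 16 * s.arr 0 (v * n + x) :=
    Nat.mod_eq_of_lt (by omega)
  refine ⟨_, (reaches_exec lookupProg ?_ s p).mono ?_, rfl, ?_, ?_⟩
  · simp [lookupProg, Cmd.block, Cmd.LoopFree]
  · simp [lookupProg, Cmd.block, Cmd.cost]
  · simp [lookupProg, Cmd.block, Cmd.exec, Memory.setReg, BinOp.eval, h0, h13, h14, e1, e2, e3]
  · simp +contextual [lookupProg, Cmd.block, Cmd.exec, Memory.setReg]

theorem testProg_spec {s : Memory} (p : ℕ) {n v x : ℕ} (ht : Tame w s.arr n)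
    (h0 : s.reg 0 = n) (h13 : s.reg 13 = v) (h14 : s.reg 14 = x) (h16 : s.reg 16 ≤ 1)
    (hv : v < n) (hx : x ≤ 2 * n) :
    ∃ s', Reaches w τ testProg s p 25 s' p ∧ s'.arr = s.arr ∧
      s'.reg 16 = (if s.reg 15 < s.reg 9 ∧ s.reg 7 < v ∧ v < x ∧ x < n ∧ s.reg 16 = 1 ∧
        s.arr 0 (v * n + x) = 1 then 1 else 0) ∧
      ∀ r ∉ [16, 19], s'.reg r = s.reg r := by
  have hw : 1 ≤ w := by
    have := ht.cube
    by_contra h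
    obtain rfl : w = 0 := by omega
    have : 0 < (n + 2) ^ 3 := by positivity
    omega
  have hite : ∀ (c : Prop) [Decidable c] (a : ℕ), a ≤ 1 → (if c then a else 0) ≤ 1 := by
    intro c _ a ha
    split_ifs <;> omega
  obtain ⟨s₁, r₁, a₁, f₁, g₁⟩ := guardProg_spec (τ := τ) (a := 15) (b := 9) p hw h16
  have b₁ : s₁.reg 16 ≤ 1 := f₁ ▸ hite _ _ h16
  obtain ⟨s₂, r₂, a₂, f₂, g₂⟩ := guardProg_spec (τ := τ) (a := 7) (b := 13) p hw b₁
  have b₂ : s₂.reg 16 ≤ 1 := f₂ ▸ hite _ _ b₁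
  obtain ⟨s₃, r₃, a₃, f₃, g₃⟩ := guardProg_spec (τ := τ) (a := 13) (b := 14) p hw b₂
  have b₃ : s₃.reg 16 ≤ 1 := f₃ ▸ hite _ _ b₂
  obtain ⟨s₄, r₄, a₄, f₄, g₄⟩ := guardProg_spec (τ := τ) (a := 14) (b := 0) p hw b₃
  have b₄ : s₄.reg 16 ≤ 1 := f₄ ▸ hite _ _ b₃
  have g : ∀ r ∉ [16, 19], s₄.reg r = s.reg r := fun r hr => by
    rw [g₄ r hr, g₃ r hr, g₂ r hr, g₁ r hr]
  have ha : s₄.arr = s.arr := by rw [a₄, a₃, a₂, a₁]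
  obtain ⟨s₅, r₅, a₅, f₅, g₅⟩ := lookupProg_spec (τ := τ) p (s := s₄) (n := n) (v := v) (x := x)
    (ha ▸ ht) (by rw [g 0 (by simp), h0]) (by rw [g 13 (by simp), h13])
    (by rw [g 14 (by simp), h14]) b₄ hv hx
  refine ⟨s₅, (r₁.seq (r₂.seq (r₃.seq (r₄.seq r₅)))).mono (by norm_num), a₅.trans ha, ?_,
    fun r hr => by rw [g₅ r hr, g r hr]⟩
  have hB := ht.matrix (v * n + x)
  rw [f₅, f₄, f₃, f₂, f₁, ha]
  simp only [g₃ 14 (by simp), g₃ 0 (by simp), g₂ 14 (by simp), g₂ 0 (by simp), g₂ 13 (by simp),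
    g₁ 14 (by simp), g₁ 0 (by simp), g₁ 13 (by simp), g₁ 7 (by simp), h0, h13, h14]
  generalize s.arr 0 (v * n + x) = B at hB
  generalize s.reg 16 = A at h16
  obtain rfl | rfl : A = 0 ∨ A = 1 := by omega
  · simp
  · obtain rfl | rfl : B = 0 ∨ B = 1 := by omega
    · simp
    · simp only [mul_one, and_true, ← ite_and]
      congr 1
      ext
      tauto

theorem recordProg_spec {s : Memory} {p n u v x j L H f : ℕ} (ht : Tame w s.arr n)
    (h7 : s.reg 7 = u) (h9 : s.reg 9 = s.arr 1 u) (h13 : s.reg 13 = v)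
    (h14 : s.reg 14 = x) (h16 : s.reg 16 = f) (h10 : s.reg 10 = j) (h11 : s.reg 11 = H)
    (h5 : s.reg 5 = L) (h18 : s.reg 18 = 1) (hf : f ≤ 1) (hH : H < 2 * n)
    (hu : u < n) (hv : v < n) (hx : x ≤ 2 * n) (hj : j < n) (hL : L ≤ 2 * n) :
    ∃ s', Reaches w τ recordProg s p 20 s' p ∧ s'.arr = s.arr ∧
      s'.reg 11 = H + f ∧ s'.reg 10 = j + L ∧
      s'.reg 17 = (if j + L < s.arr 1 u then 1 else 0) ∧
      (if f = 1 then s'.reg 1 = u ∧ s'.reg 2 = v ∧ s'.reg 3 = x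
        else s'.reg 1 = s.reg 1 ∧ s'.reg 2 = s.reg 2 ∧ s'.reg 3 = s.reg 3) ∧
      ∀ r ∉ [1, 2, 3, 10, 11, 17], s'.reg r = s.reg r := by
  have hn := ht.pos
  have hW' := ht.square
  have e1 : (1 : ℕ) % 2 ^ w = 1 := Nat.mod_eq_of_lt (by omega)
  have e2 : (H + f) % 2 ^ w = H + f := Nat.mod_eq_of_lt (by omega)
  have e3 : u % 2 ^ w = u := Nat.mod_eq_of_lt (by omega)
  have e4 : v % 2 ^ w = v := Nat.mod_eq_of_lt (by omega)
  have e5 : x % 2 ^ w = x := Nat.mod_eq_of_lt (by omega)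
  have e6 : (j + L) % 2 ^ w = j + L := Nat.mod_eq_of_lt (by omega)
  have hite := ite_mod_of_one e1
  have hpos : (recordProg.exec w τ s p).2 = p := by
    by_cases h : s.reg 16 = 0 <;>
      simp [recordProg, Cmd.block, Cmd.exec, Memory.setReg, h]
  have hre : Reaches w τ recordProg s p 20 (recordProg.exec w τ s p).1 p := by
    have := reaches_exec (τ := τ) recordProg (by simp [recordProg, Cmd.block, Cmd.LoopFree]) s p
    rw [hpos] at this
    exact this.mono (by simp [recordProg, Cmd.block, Cmd.cost])
  refine ⟨_, hre, ?_⟩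
  obtain rfl | rfl : f = 0 ∨ f = 1 := by omega
  · rw [add_zero] at e2
    simp +contextual [recordProg, Cmd.block, Cmd.exec, Memory.setReg, BinOp.eval,
      h5, h9, h10, h11, h16, e2, e6, hite]
  · simp +contextual [recordProg, Cmd.block, Cmd.exec, Memory.setReg, BinOp.eval,
      h5, h7, h9, h10, h11, h13, h14, h16, h18, e2, e3, e4, e5, e6, hite]

theorem trialProg_spec {s : Memory} {p n L N u j H : ℕ} (ht : Tame w s.arr n)
    (h0 : s.reg 0 = n) (h5 : s.reg 5 = L) (h6 : s.reg 6 = N) (h7 : s.reg 7 = u)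
    (h9 : s.reg 9 = s.arr 1 u) (h10 : s.reg 10 = j) (h11 : s.reg 11 = H) (h18 : s.reg 18 = 1)
    (hL0 : 0 < L) (hN0 : 0 < N) (hL : L ≤ 2 * n) (hN : N ≤ 2 * n) (hu : u < n) (hj : j < n)
    (hH : H < 2 * n) :
    ∃ s', Reaches w τ trialProg s p 70 s' (p + 1) ∧ s'.arr = s.arr ∧
      s'.reg 11 = H + hit s.arr n L N u j (τ p) ∧ s'.reg 10 = j + L ∧
      s'.reg 17 = (if j + L < s.arr 1 u then 1 else 0) ∧
      (∀ r ∈ [0, 5, 6, 7, 9, 18], s'.reg r = s.reg r) ∧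
      (if hit s.arr n L N u j (τ p) = 1 then
        s'.reg 1 = u ∧ s'.reg 2 = s.arr 2 (u * n + (j + (τ p : ℕ) % L)) ∧
          s'.reg 3 = (τ p : ℕ) / L % N
      else s'.reg 1 = s.reg 1 ∧ s'.reg 2 = s.reg 2 ∧ s'.reg 3 = s.reg 3) := by
  obtain ⟨s₁, r₁, a₁, f15, f14, f13, f16, g₁⟩ :=
    drawProg_spec (τ := τ) (p := p) ht h0 h5 h6 h7 h10 hL0 hN0 hL hN hu hj
  have hx : (τ p : ℕ) / L % N ≤ 2 * n := (Nat.mod_lt _ hN0).le.trans hN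
  have hv := ht.list (u * n + (j + (τ p : ℕ) % L))
  obtain ⟨s₂, r₂, a₂, f₂, g₂⟩ := testProg_spec (τ := τ) (p + 1) (s := s₁) (a₁ ▸ ht)
    (by rw [g₁ 0 (by simp), h0]) f13 f14 (f16 ▸ ht.matrix _) hv hx
  rw [f15, f16, a₁, g₁ 9 (by simp), h9, g₁ 7 (by simp), h7] at f₂
  replace f₂ : s₂.reg 16 = hit s.arr n L N u j (τ p) := f₂
  have hle := hit_le_one s.arr n L N u j (τ p)
  have ha : s₂.arr = s.arr := a₂.trans a₁
  obtain ⟨s₃, r₃, a₃, f11, f10, f17, f1, g₃⟩ := recordProg_spec (τ := τ) (p := p + 1) (s := s₂)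
    (ha ▸ ht) (by rw [g₂ 7 (by simp), g₁ 7 (by simp), h7])
    (by rw [g₂ 9 (by simp), g₁ 9 (by simp), h9, ha]) (by rw [g₂ 13 (by simp), f13])
    (by rw [g₂ 14 (by simp), f14]) f₂ (by rw [g₂ 10 (by simp), g₁ 10 (by simp), h10])
    (by rw [g₂ 11 (by simp), g₁ 11 (by simp), h11]) (by rw [g₂ 5 (by simp), g₁ 5 (by simp), h5])
    (by rw [g₂ 18 (by simp), g₁ 18 (by simp), h18]) hle hH hu hv hx hj hL
  refine ⟨s₃, (r₁.seq (r₂.seq r₃)).mono (by norm_num), a₃.trans ha, f11, f10, ha ▸ f17, ?_, ?_⟩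
  · intro r hr
    have h1 : r ∉ [1, 2, 3, 10, 11, 17] := by
      fin_cases hr <;> simp
    have h2 : r ∉ [16, 19] := by
      fin_cases hr <;> simp
    have h3 : r ∉ [12, 13, 14, 15, 16] := by
      fin_cases hr <;> simp
    rw [g₃ r h1, g₂ r h2, g₁ r h3]
  · rw [g₂ 1 (by simp), g₂ 2 (by simp), g₂ 3 (by simp), g₁ 1 (by simp), g₁ 2 (by simp),
      g₁ 3 (by simp)] at f1
    exact f1

end Prog

/-! ### Scanning all vertices -/

/-- Runs through the neighbours of the vertex in register `7` in blocks of length `L`, with one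
trial per block, and goes on to the next vertex. -/
def vertexProg : Cmd :=
  .seq (Cmd.block [.load 9 1 7, .const 10 0, .op .lt 17 10 9])
    (.seq (.loop 17 trialProg) (Cmd.block [.op .add 7 7 18, .op .lt 8 7 0]))

/-- Runs `vertexProg` for every vertex. -/
def scanProg : Cmd :=
  .seq (Cmd.block [.const 7 0, .op .lt 8 7 0]) (.loop 8 vertexProg)

/-- The triangle estimator.  Register `18` holds the constant `1`, the registers `4`, `5`, `6`
receive the sum of the degrees, `L` and `N`, and the number of successful trials is counted in register
`11`. -/
def mainProg : Cmd :=
  .seq (.const 18 1) (.seq sumProg (.seq (powProg 5 0 4) (.seq (powProg 6 18 0)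
    (.seq scanProg (Cmd.block [.op .mul 0 11 5, .op .mul 0 0 6])))))

/-- The number of blocks of length `L` that cover the neighbours of `u`. -/
def blocks (arr : ℕ → ℕ → ℕ) (L u : ℕ) : ℕ := (arr 1 u + L - 1) / L

/-- The number of trials made before vertex `u`; this is also the number of random words consumed
by then. -/
def firstTrial (arr : ℕ → ℕ → ℕ) (L u : ℕ) : ℕ := ∑ u' ∈ Finset.range u, blocks arr L u'

/-- The number of successful trials at vertex `u`. -/
def vertexHits {w : ℕ} (τ : ℕ → Fin (2 ^ w)) (arr : ℕ → ℕ → ℕ) (n L N u k : ℕ) : ℕ :=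
  ∑ b ∈ Finset.range k, hit arr n L N u (b * L) (τ (firstTrial arr L u + b))

/-- The number of successful trials at the vertices below `k`. -/
def hits {w : ℕ} (τ : ℕ → Fin (2 ^ w)) (arr : ℕ → ℕ → ℕ) (n L N k : ℕ) : ℕ :=
  ∑ u ∈ Finset.range k, vertexHits τ arr n L N u (blocks arr L u)

theorem lt_blocks_iff {arr : ℕ → ℕ → ℕ} {L u b : ℕ} (hL : 0 < L) :
    b < blocks arr L u ↔ b * L < arr 1 u := by
  unfold blocks
  rw [← Nat.succ_le_iff, Nat.le_div_iff_mul_le hL, Nat.succ_mul]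
  omega

section Prog

variable {w : ℕ} {τ : ℕ → Fin (2 ^ w)}

theorem sumProg_spec {s : Memory} (p : ℕ) {n : ℕ} (ht : Tame w s.arr n) (h0 : s.reg 0 = n)
    (h4 : s.reg 4 = 0) (h7 : s.reg 7 = 0) (h18 : s.reg 18 = 1) :
    ∃ s', Reaches w τ sumProg s p (10 * n + 3) s' p ∧ s'.arr = s.arr ∧
      s'.reg 4 = ∑ u ∈ Finset.range n, s.arr 1 u ∧ ∀ r ∉ [4, 7, 8, 9], s'.reg r = s.reg r := by
  have hn := ht.pos
  have hW' := ht.square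
  have e1 : (1 : ℕ) % 2 ^ w = 1 := Nat.mod_eq_of_lt (by omega)
  have hite := ite_mod_of_one e1
  have hsum : ∀ j ≤ n, ∑ u ∈ Finset.range j, s.arr 1 u ≤ n ^ 2 := fun j hj => by
    calc ∑ u ∈ Finset.range j, s.arr 1 u ≤ ∑ u ∈ Finset.range j, n :=
          Finset.sum_le_sum fun u _ => ht.degree u
      _ = j * n := by simp
      _ ≤ n ^ 2 := by nlinarith
  set I : ℕ → Memory → ℕ → Prop := fun j t q => q = p ∧ t.arr = s.arr ∧ t.reg 7 = j ∧
    t.reg 4 = ∑ u ∈ Finset.range j, s.arr 1 u ∧ t.reg 8 = (if j < n then 1 else 0) ∧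
    ∀ r ∉ [4, 7, 8, 9], t.reg r = s.reg r with hI
  have h1 := Reaches.of_step (τ := τ) (c := .op .lt 8 7 0) (s := s) (p := p) (p' := p)
    (s' := s.setReg 8 (if 0 < n then 1 else 0)) (fun l => by
      simp only [step, BinOp.eval, h7, h0, hite])
  refine (reaches_loop (τ := τ) (x := 8)
    (c := Cmd.block [.load 9 1 7, .op .add 4 4 9, .op .add 7 7 18, .op .lt 8 7 0]) I
    (fun _ => 9) n ?_ ?_ (s.setReg 8 (if 0 < n then 1 else 0)) p ?_).elim ?_
  · rintro j hj t q ⟨rfl, ha, f7, f4, f8, fr⟩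
    refine ⟨by simp [f8, hj], _, _, reaches_exec _ ?_ t q, ?_, ?_, ?_, ?_, ?_, ?_⟩
    · simp [Cmd.block, Cmd.LoopFree]
    · rfl
    · exact ha
    · have e2 : (j + 1) % 2 ^ w = j + 1 := Nat.mod_eq_of_lt (by nlinarith)
      simp [Cmd.block, Cmd.exec, Memory.setReg, BinOp.eval, f7, fr 18 (by simp), h18, e2]
    · have := hsum (j + 1) hj
      rw [Finset.sum_range_succ] at this
      rw [Finset.sum_range_succ]
      have e2 := Nat.mod_eq_of_lt (show ∑ u ∈ Finset.range j, s.arr 1 u + s.arr 1 j < 2 ^ w by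
        omega)
      simp [Cmd.block, Cmd.exec, Memory.setReg, BinOp.eval, f7, f4, ha, e2]
    · have e2 : (j + 1) % 2 ^ w = j + 1 := Nat.mod_eq_of_lt (by nlinarith)
      simp [Cmd.block, Cmd.exec, Memory.setReg, BinOp.eval, f7, fr 18 (by simp), h18, e2,
        fr 0 (by simp), h0, hite]
    · intro r hr
      have := fr r hr
      simp only [List.mem_cons, List.not_mem_nil, or_false, not_or] at hr
      simp [Cmd.block, Cmd.exec, Memory.setReg, hr, this]
  · rintro t q ⟨rfl, ha, f7, f4, f8, fr⟩
    simp [f8]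
  · refine ⟨rfl, rfl, ?_, ?_, ?_, ?_⟩
    · simp [Memory.setReg, h7]
    · simp [Memory.setReg, h4]
    · simp [Memory.setReg]
    · intro r hr
      simp only [List.mem_cons, List.not_mem_nil, or_false, not_or] at hr
      simp [Memory.setReg, hr]
  · rintro s' ⟨p', h2, rfl, h3, -, h5, -, h6⟩
    refine ⟨s', (h1.seq h2).mono ?_, h3, h5, h6⟩
    simp
    omega

theorem powProg_spec {s : Memory} (p : ℕ) {x y a ℓ : ℕ} (hx : x ∉ [8, 9])
    (hy : y ∉ [8, 9, x]) (ha : a ∉ [8, 9, x]) (hw : 1 ≤ w)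
    (hW : 2 * s.reg a < 2 ^ w) (hW' : s.reg y < 2 ^ w) (hy0 : 0 < s.reg y)
    (hℓ : ∀ i < ℓ, 2 ^ i * s.reg y < s.reg a) (hℓ' : s.reg a ≤ 2 ^ ℓ * s.reg y) :
    ∃ s', Reaches w τ (powProg x y a) s p (8 * ℓ + 9) s' p ∧ s'.arr = s.arr ∧
      s'.reg x = 2 ^ ℓ ∧ ∀ r ∉ [8, 9, x], s'.reg r = s.reg r := by
  simp only [List.mem_cons, List.not_mem_nil, or_false, not_or] at hx hy ha
  obtain ⟨hx8, hx9⟩ := hx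
  obtain ⟨hy8, hy9, hyx⟩ := hy
  obtain ⟨ha8, ha9, hax⟩ := ha
  have hW1 : 2 ^ 1 ≤ 2 ^ w := Nat.pow_le_pow_right (by omega) hw
  have e1 : (1 : ℕ) % 2 ^ w = 1 := Nat.mod_eq_of_lt (by omega)
  have hite := ite_mod_of_one e1
  have hbd : ∀ i ≤ ℓ, 2 ^ i * s.reg y < 2 ^ w := by
    intro i hi
    rcases i with _ | i
    · simpa using hW'
    · have := hℓ i (by omega)
      rw [pow_succ]
      nlinarith
  have hbd' : ∀ i ≤ ℓ, 2 ^ i < 2 ^ w := fun i hi => by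
    have := hbd i hi
    nlinarith [Nat.le_mul_of_pos_right (2 ^ i) hy0]
  set I : ℕ → Memory → ℕ → Prop := fun j t q => q = p ∧ t.arr = s.arr ∧ t.reg x = 2 ^ j ∧
    t.reg 8 = (if j < ℓ then 1 else 0) ∧
    ∀ r ∉ [8, 9, x], t.reg r = s.reg r with hI
  have hlt : ∀ j ≤ ℓ, (2 ^ j * s.reg y < s.reg a ↔ j < ℓ) := fun j hj => by
    rcases hj.lt_or_eq with h | rfl
    · simp [h, hℓ j h]
    · simpa using hℓ'
  have h1 := reaches_exec (τ := τ) (Cmd.block [.const x 1, .op .mul 9 x y, .op .lt 8 9 a])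
    (by simp [Cmd.block, Cmd.LoopFree]) s p
  refine (reaches_loop (τ := τ) (x := 8)
    (c := Cmd.block [.op .add x x x, .op .mul 9 x y, .op .lt 8 9 a]) I
    (fun _ => 7) ℓ ?_ ?_
    (Cmd.exec w τ (Cmd.block [.const x 1, .op .mul 9 x y, .op .lt 8 9 a]) s p).1
    (Cmd.exec w τ (Cmd.block [.const x 1, .op .mul 9 x y, .op .lt 8 9 a]) s p).2 ?_).elim ?_
  · rintro j hj t q ⟨rfl, har, fx, f8, fr⟩
    have e2 : (2 ^ j + 2 ^ j) % 2 ^ w = 2 ^ (j + 1) := by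
      rw [Nat.mod_eq_of_lt]
      · ring
      · have := hbd' (j + 1) hj
        rw [pow_succ] at this
        omega
    have e3 := Nat.mod_eq_of_lt (hbd (j + 1) hj)
    have fa := fr a (by simp [*])
    have fy := fr y (by simp [*])
    refine ⟨by simp [f8, hj], _, _, (reaches_exec _ ?_ t q).mono ?_, ?_, ?_, ?_, ?_, ?_⟩
    · simp [Cmd.block, Cmd.LoopFree]
    · simp [Cmd.block, Cmd.cost]
    · rfl
    · exact har
    · simp [Cmd.block, Cmd.exec, Memory.setReg, BinOp.eval, fx, e2, hx8, hx9]
    · simp [Cmd.block, Cmd.exec, Memory.setReg, BinOp.eval, fx, fa, fy, e2, e3, ha9, hax, hyx,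
        hite, hlt (j + 1) hj]
    · intro r hr
      have := fr r hr
      simp only [List.mem_cons, List.not_mem_nil, or_false, not_or] at hr
      simp [Cmd.block, Cmd.exec, Memory.setReg, Function.update_apply, hr, this]
  · rintro t q ⟨rfl, ha, fx, f8, fr⟩
    simp [f8]
  · have e3 := Nat.mod_eq_of_lt hW'
    have := hlt 0 (by omega)
    rw [pow_zero, one_mul] at this
    refine ⟨rfl, rfl, ?_, ?_, ?_⟩
    · simp [Cmd.block, Cmd.exec, Memory.setReg, e1, hx8, hx9]
    · simp [Cmd.block, Cmd.exec, Memory.setReg, BinOp.eval, e1, e3, ha9, hax, hyx, hite, this]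
    · intro r hr
      simp only [List.mem_cons, List.not_mem_nil, or_false, not_or] at hr
      simp [Cmd.block, Cmd.exec, Memory.setReg, Function.update_apply, hr]
  · rintro s' ⟨p', h2, rfl, h3, h4, -, h6⟩
    exact ⟨s', (h1.seq h2).mono (by simp [Cmd.block, Cmd.cost]; omega), h3, h4, h6⟩

/-- The invariant of the scan.  A property `F` that holds for every successful trial holds for the
registers `1`, `2`, `3` as soon as the counter is positive. -/
theorem vertexProg_spec {s : Memory} {n L N u : ℕ} {F : ℕ → ℕ → ℕ → Prop} (ht : Tame w s.arr n)
    (h0 : s.reg 0 = n) (h5 : s.reg 5 = L) (h6 : s.reg 6 = N) (h7 : s.reg 7 = u)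
    (h11 : s.reg 11 = hits τ s.arr n L N u) (h18 : s.reg 18 = 1)
    (hL0 : 0 < L) (hN0 : 0 < N) (hL : L ≤ 2 * n) (hN : N ≤ 2 * n) (hu : u < n)
    (hS : firstTrial s.arr L (u + 1) ≤ 2 * n)
    (hits_le : hits τ s.arr n L N u ≤ firstTrial s.arr L u)
    (hF : ∀ j r, hit s.arr n L N u j r = 1 →
      F u (s.arr 2 (u * n + (j + r % L))) (r / L % N))
    (hF' : 0 < s.reg 11 → F (s.reg 1) (s.reg 2) (s.reg 3)) :
    ∃ s', Reaches w τ vertexProg s (firstTrial s.arr L u) (71 * blocks s.arr L u + 15) s'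
        (firstTrial s.arr L (u + 1)) ∧ s'.arr = s.arr ∧
      s'.reg 7 = u + 1 ∧ s'.reg 8 = (if u + 1 < n then 1 else 0) ∧
      s'.reg 11 = hits τ s.arr n L N (u + 1) ∧
      (∀ r ∈ [0, 5, 6, 18], s'.reg r = s.reg r) ∧
      (0 < s'.reg 11 → F (s'.reg 1) (s'.reg 2) (s'.reg 3)) := by
  have hn := ht.pos
  have hW' := ht.square
  have e1 : (1 : ℕ) % 2 ^ w = 1 := Nat.mod_eq_of_lt (by omega)
  have hite := ite_mod_of_one e1
  obtain ⟨S, hSu⟩ : ∃ S, firstTrial s.arr L u = S := ⟨_, rfl⟩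
  have hS1 : firstTrial s.arr L (u + 1) = S + blocks s.arr L u := by
    rw [← hSu]
    exact Finset.sum_range_succ _ _
  rw [hSu] at hits_le ⊢
  set I : ℕ → Memory → ℕ → Prop := fun b t q => q = S + b ∧ t.arr = s.arr ∧
    t.reg 11 = hits τ s.arr n L N u + vertexHits τ s.arr n L N u b ∧ t.reg 10 = b * L ∧
    t.reg 9 = s.arr 1 u ∧ t.reg 17 = (if b * L < s.arr 1 u then 1 else 0) ∧
    (∀ r ∈ [0, 5, 6, 7, 18], t.reg r = s.reg r) ∧
    (0 < t.reg 11 → F (t.reg 1) (t.reg 2) (t.reg 3)) with hI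
  have h1 := reaches_exec (τ := τ) (Cmd.block [.load 9 1 7, .const 10 0, .op .lt 17 10 9])
    (by simp [Cmd.block, Cmd.LoopFree]) s S
  refine (reaches_loop (τ := τ) (x := 17)
    (c := trialProg) I (fun _ => 70) (blocks s.arr L u) ?_ ?_
    (Cmd.exec w τ (Cmd.block [.load 9 1 7, .const 10 0, .op .lt 17 10 9]) s S).1
    (Cmd.exec w τ (Cmd.block [.load 9 1 7, .const 10 0, .op .lt 17 10 9]) s S).2 ?_).elim ?_
  · rintro b hb t q ⟨rfl, har, f11, f10, f9, f17, fr, fF⟩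
    have hb' := (lt_blocks_iff hL0).1 hb
    have hvb : vertexHits τ s.arr n L N u b ≤ b := by
      calc vertexHits τ s.arr n L N u b ≤ ∑ _ ∈ Finset.range b, 1 :=
            Finset.sum_le_sum fun _ _ => hit_le_one _ _ _ _ _ _ _
        _ = b := by simp
    have hd := ht.degree u
    obtain ⟨s', r, ha, g11, g10, g17, gr, gF⟩ := trialProg_spec (τ := τ) (s := t) (p := S + b)
      (n := n) (L := L) (N := N) (u := u) (j := b * L) (har ▸ ht) (by rw [fr 0 (by simp), h0])
      (by rw [fr 5 (by simp), h5]) (by rw [fr 6 (by simp), h6]) (by rw [fr 7 (by simp), h7])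
      (by rw [f9, har]) f10 f11 (by rw [fr 18 (by simp), h18]) hL0 hN0 hL hN hu (by omega)
      (by omega)
    rw [har] at g11 g17 gF
    refine ⟨by simp [f17, hb'], s', _, r, by omega, ha.trans har, ?_, ?_, ?_, ?_, ?_, ?_⟩
    · rw [g11, vertexHits, vertexHits, Finset.sum_range_succ, add_assoc, hSu]
    · rw [g10]
      ring
    · rw [gr 9 (by simp), f9]
    · rw [g17, Nat.succ_mul]
    · intro r hr
      rw [gr r (by fin_cases hr <;> simp), fr r hr]
    · intro hpos
      split_ifs at gF with hh
      · rw [gF.1, gF.2.1, gF.2.2]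
        exact hF _ _ hh
      · rw [gF.1, gF.2.1, gF.2.2]
        apply fF
        have := hit_le_one s.arr n L N u (b * L) (τ (S + b))
        omega
  · rintro t q ⟨rfl, har, f11, f10, f9, f17, fr, fF⟩
    rw [f17, if_neg]
    rw [← lt_blocks_iff hL0]
    exact lt_irrefl _
  · refine ⟨rfl, rfl, ?_, ?_, ?_, ?_, ?_, ?_⟩
    · simp [Cmd.block, Cmd.exec, Memory.setReg, h11, vertexHits]
    · simp [Cmd.block, Cmd.exec, Memory.setReg]
    · simp [Cmd.block, Cmd.exec, Memory.setReg, h7]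
    · simp [Cmd.block, Cmd.exec, Memory.setReg, BinOp.eval, h7, hite]
    · intro r hr
      have h7' : r ≠ 9 := by rintro rfl; simp at hr
      have h8' : r ≠ 10 := by rintro rfl; simp at hr
      have h9' : r ≠ 17 := by rintro rfl; simp at hr
      simp [Cmd.block, Cmd.exec, Memory.setReg, h7', h8', h9']
    · simpa [Cmd.block, Cmd.exec, Memory.setReg] using hF'
  · rintro t ⟨q, h2, rfl, h3, f11, -, -, -, fr, fF⟩
    have h4 := reaches_exec (τ := τ) (Cmd.block [.op .add 7 7 18, .op .lt 8 7 0])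
      (by simp [Cmd.block, Cmd.LoopFree]) t (S + blocks s.arr L u)
    have e2 : (u + 1) % 2 ^ w = u + 1 := Nat.mod_eq_of_lt (by nlinarith)
    rw [hS1]
    refine ⟨_, (h1.seq (h2.seq h4)).mono ?_, h3, ?_, ?_, ?_, ?_, ?_⟩
    · simp [Cmd.block, Cmd.cost]
      omega
    · simp [Cmd.block, Cmd.exec, Memory.setReg, BinOp.eval, fr 7, fr 18, h7, h18, e2]
    · simp [Cmd.block, Cmd.exec, Memory.setReg, BinOp.eval, fr 7, fr 18, fr 0, h0, h7, h18, e2,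
        hite]
    · simp [Cmd.block, Cmd.exec, Memory.setReg, f11, hits, Finset.sum_range_succ]
    · intro r hr
      have := fr r (by fin_cases hr <;> simp)
      have h7' : r ≠ 7 := by rintro rfl; simp at hr
      have h8' : r ≠ 8 := by rintro rfl; simp at hr
      simp [Cmd.block, Cmd.exec, Memory.setReg, this, h7', h8']
    · simpa [Cmd.block, Cmd.exec, Memory.setReg] using fF

theorem firstTrial_mono (arr : ℕ → ℕ → ℕ) (L : ℕ) : Monotone (firstTrial arr L) :=
  fun _ _ h => Finset.sum_le_sum_of_subset (Finset.range_mono h)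

theorem hits_le_firstTrial (arr : ℕ → ℕ → ℕ) (n L N k : ℕ) :
    hits τ arr n L N k ≤ firstTrial arr L k :=
  Finset.sum_le_sum fun u _ => by
    calc vertexHits τ arr n L N u (blocks arr L u) ≤ ∑ _ ∈ Finset.range (blocks arr L u), 1 :=
          Finset.sum_le_sum fun _ _ => hit_le_one _ _ _ _ _ _ _
      _ = blocks arr L u := by simp

theorem scanProg_spec {s : Memory} {n L N : ℕ} {F : ℕ → ℕ → ℕ → Prop} (ht : Tame w s.arr n)
    (h0 : s.reg 0 = n) (h5 : s.reg 5 = L) (h6 : s.reg 6 = N)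
    (h11 : s.reg 11 = 0) (h18 : s.reg 18 = 1)
    (hL0 : 0 < L) (hN0 : 0 < N) (hL : L ≤ 2 * n) (hN : N ≤ 2 * n)
    (hS : firstTrial s.arr L n ≤ 2 * n)
    (hF : ∀ u < n, ∀ j r, hit s.arr n L N u j r = 1 →
      F u (s.arr 2 (u * n + (j + r % L))) (r / L % N)) :
    ∃ s' p', Reaches w τ scanProg s 0 (160 * n + 10) s' p' ∧ s'.arr = s.arr ∧
      s'.reg 11 = hits τ s.arr n L N n ∧
      (∀ r ∈ [0, 5, 6, 18], s'.reg r = s.reg r) ∧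
      (0 < s'.reg 11 → F (s'.reg 1) (s'.reg 2) (s'.reg 3)) := by
  have hn := ht.pos
  have hW' := ht.square
  have e1 : (1 : ℕ) % 2 ^ w = 1 := Nat.mod_eq_of_lt (by omega)
  set I : ℕ → Memory → ℕ → Prop := fun u t q => q = firstTrial s.arr L u ∧ t.arr = s.arr ∧
    t.reg 7 = u ∧ t.reg 8 = (if u < n then 1 else 0) ∧ t.reg 11 = hits τ s.arr n L N u ∧
    (∀ r ∈ [0, 5, 6, 18], t.reg r = s.reg r) ∧
    (0 < t.reg 11 → F (t.reg 1) (t.reg 2) (t.reg 3)) with hI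
  have h1 := reaches_exec (τ := τ) (Cmd.block [.const 7 0, .op .lt 8 7 0])
    (by simp [Cmd.block, Cmd.LoopFree]) s 0
  refine (reaches_loop (τ := τ) (x := 8)
    (c := vertexProg) I (fun u => 71 * blocks s.arr L u + 15) n ?_ ?_
    (Cmd.exec w τ (Cmd.block [.const 7 0, .op .lt 8 7 0]) s 0).1
    (Cmd.exec w τ (Cmd.block [.const 7 0, .op .lt 8 7 0]) s 0).2 ?_).elim ?_
  · rintro u hu t q ⟨rfl, har, f7, f8, f11, fr, fF⟩
    obtain ⟨s', r, ha, g7, g8, g11, gr, gF⟩ := vertexProg_spec (τ := τ) (s := t) (n := n) (L := L)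
      (N := N) (u := u) (F := F) (har ▸ ht) (by rw [fr 0 (by simp), h0])
      (by rw [fr 5 (by simp), h5]) (by rw [fr 6 (by simp), h6]) f7 (by rw [f11, har])
      (by rw [fr 18 (by simp), h18]) hL0 hN0 hL hN hu
      (har ▸ (firstTrial_mono _ _ hu).trans hS) (hits_le_firstTrial _ _ _ _ _)
      (har ▸ hF u hu) fF
    rw [har] at r g11
    refine ⟨by simp [f8, hu], s', _, r, rfl, ha.trans har, g7, g8, g11, fun r hr => ?_, gF⟩
    rw [gr r hr, fr r hr]
  · rintro t q ⟨rfl, har, f7, f8, f11, fr, fF⟩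
    simp [f8]
  · refine ⟨rfl, rfl, ?_, ?_, ?_, ?_, ?_⟩
    · simp [Cmd.block, Cmd.exec, Memory.setReg]
    · simp [Cmd.block, Cmd.exec, Memory.setReg, BinOp.eval, h0, show 0 < n from hn, e1]
    · simp [Cmd.block, Cmd.exec, Memory.setReg, h11, hits]
    · intro r hr
      have h7' : r ≠ 7 := by rintro rfl; simp at hr
      have h8' : r ≠ 8 := by rintro rfl; simp at hr
      simp [Cmd.block, Cmd.exec, Memory.setReg, h7', h8']
    · simp [Cmd.block, Cmd.exec, Memory.setReg, h11]
  · rintro t ⟨q, h2, rfl, h3, -, -, f11, fr, fF⟩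
    refine ⟨t, _, (h1.seq h2).mono ?_, h3, f11, fr, fF⟩
    have : ∑ j ∈ Finset.range n, (71 * blocks s.arr L j + 15 + 1) =
        71 * firstTrial s.arr L n + 16 * n := by
      simp only [Finset.sum_add_distrib, ← Finset.mul_sum, firstTrial]
      simp
      ring
    rw [this]
    simp [Cmd.block, Cmd.cost]
    omega

end Prog

/-! ### Correctness and running time of the estimator -/

theorem pow_le_two_mul {n M y ℓ : ℕ} (hn : 1 ≤ n) (hM : M ≤ y * n)
    (hℓ : ∀ i < ℓ, 2 ^ i * y < M) : 2 ^ ℓ ≤ 2 * n ∧ ℓ ≤ n := by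
  rcases ℓ with _ | i
  · simp
    omega
  · have h1 : 2 ^ i * y < y * n := (hℓ i (by omega)).trans_le hM
    have h2 : 2 ^ i < n := by
      by_contra h
      push Not at h
      nlinarith [Nat.mul_le_mul_left y h]
    have h3 : i < 2 ^ i := Nat.lt_two_pow_self
    rw [pow_succ]
    omega

/-- Each vertex contributes at most one incomplete block, so there are at most `2 n` trials. -/
theorem firstTrial_le {arr : ℕ → ℕ → ℕ} {n L : ℕ} (hL0 : 0 < L)
    (hL : ∑ u ∈ Finset.range n, arr 1 u ≤ L * n) : firstTrial arr L n ≤ 2 * n := by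
  have h : L * firstTrial arr L n ≤ L * (2 * n) := by
    calc L * firstTrial arr L n = ∑ u ∈ Finset.range n, L * blocks arr L u := by
          rw [firstTrial, Finset.mul_sum]
      _ ≤ ∑ u ∈ Finset.range n, (arr 1 u + L) := by
          refine Finset.sum_le_sum fun u _ => (Nat.mul_div_le _ _).trans ?_
          omega
      _ = ∑ u ∈ Finset.range n, arr 1 u + n * L := by simp [Finset.sum_add_distrib]
      _ ≤ L * (2 * n) := by nlinarith
  exact Nat.le_of_mul_le_mul_left h hL0

theorem mainProg_spec {w : ℕ} {τ : ℕ → Fin (2 ^ w)} {s : Memory} {n ℓ a : ℕ}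
    {F : ℕ → ℕ → ℕ → Prop} (ht : Tame w s.arr n) (hreg : ∀ x, s.reg x = if x = 0 then n else 0)
    (hℓ : ∀ i < ℓ, 2 ^ i * n < ∑ u ∈ Finset.range n, s.arr 1 u)
    (hℓ' : ∑ u ∈ Finset.range n, s.arr 1 u ≤ 2 ^ ℓ * n)
    (ha : ∀ i < a, 2 ^ i < n) (ha' : n ≤ 2 ^ a)
    (hF : ∀ u < n, ∀ j r, hit s.arr n (2 ^ ℓ) (2 ^ a) u j r = 1 →
      F u (s.arr 2 (u * n + (j + r % 2 ^ ℓ))) (r / 2 ^ ℓ % 2 ^ a)) :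
    ∃ s' p', Reaches w τ mainProg s 0 (300 * n) s' p' ∧
      s'.reg 0 = hits τ s.arr n (2 ^ ℓ) (2 ^ a) n * 2 ^ ℓ * 2 ^ a ∧
      (0 < hits τ s.arr n (2 ^ ℓ) (2 ^ a) n → F (s'.reg 1) (s'.reg 2) (s'.reg 3)) := by
  have hn := ht.pos
  have hW := ht.cube
  have hW' := ht.square
  have hw : 1 ≤ w := by
    by_contra h
    obtain rfl : w = 0 := by omega
    omega
  have e1 : (1 : ℕ) % 2 ^ w = 1 := Nat.mod_eq_of_lt (by omega)
  have hM : ∑ u ∈ Finset.range n, s.arr 1 u ≤ n * n := by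
    calc ∑ u ∈ Finset.range n, s.arr 1 u ≤ ∑ u ∈ Finset.range n, n :=
          Finset.sum_le_sum fun u _ => ht.degree u
      _ = n * n := by simp
  obtain ⟨hL, hℓn⟩ := pow_le_two_mul hn hM hℓ
  obtain ⟨hN, han⟩ := pow_le_two_mul (y := 1) (M := n) hn (by simp) (by simpa using ha)
  have r₀ : Reaches w τ (.const 18 1) s 0 1 (s.setReg 18 1) 0 :=
    Reaches.of_step fun l => by simp [step, e1]
  obtain ⟨s₁, r₁, a₁, f4, g₁⟩ := sumProg_spec (τ := τ) (s := s.setReg 18 1) 0 (n := n) ht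
    (by simp [Memory.setReg, hreg]) (by simp [Memory.setReg, hreg])
    (by simp [Memory.setReg, hreg]) (by simp [Memory.setReg])
  have g₁0 : s₁.reg 0 = n := by
    rw [g₁ 0 (by simp)]
    simp [Memory.setReg, hreg]
  replace a₁ : s₁.arr = s.arr := a₁
  replace f4 : s₁.reg 4 = ∑ u ∈ Finset.range n, s.arr 1 u := f4
  obtain ⟨s₂, r₂, a₂, f5, g₂⟩ := powProg_spec (τ := τ) (s := s₁) 0 (x := 5) (y := 0) (a := 4)
    (ℓ := ℓ) (by simp) (by simp) (by simp) hw (by rw [f4]; nlinarith) (by rw [g₁0]; omega)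
    (by rw [g₁0]; omega) (by rw [g₁0, f4]; exact hℓ) (by rw [g₁0, f4]; exact hℓ')
  have g₂0 : s₂.reg 0 = n := by rw [g₂ 0 (by simp), g₁0]
  have g₂18 : s₂.reg 18 = 1 := by
    rw [g₂ 18 (by simp), g₁ 18 (by simp)]
    simp [Memory.setReg]
  obtain ⟨s₃, r₃, a₃, f6, g₃⟩ := powProg_spec (τ := τ) (s := s₂) 0 (x := 6) (y := 18) (a := 0)
    (ℓ := a) (by simp) (by simp) (by simp) hw (by rw [g₂0]; omega) (by rw [g₂18]; omega)
    (by rw [g₂18]; omega) (by rw [g₂0, g₂18]; simpa using ha)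
    (by rw [g₂0, g₂18]; simpa using ha')
  have h₃a : s₃.arr = s.arr := by rw [a₃, a₂, a₁]
  have hS := firstTrial_le (arr := s.arr) (n := n) (L := 2 ^ ℓ) (by positivity) hℓ'
  obtain ⟨s₄, p', r₄, a₄, f11, g₄, gF⟩ := scanProg_spec (τ := τ) (s := s₃) (n := n) (L := 2 ^ ℓ)
    (N := 2 ^ a) (F := F) (h₃a ▸ ht) (by rw [g₃ 0 (by simp), g₂0]) (by rw [g₃ 5 (by simp), f5]) f6
    (by rw [g₃ 11 (by simp), g₂ 11 (by simp), g₁ 11 (by simp)]; simp [Memory.setReg, hreg])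
    (by rw [g₃ 18 (by simp), g₂18]) (by positivity) (by positivity) hL hN
    (h₃a ▸ hS) (h₃a ▸ hF)
  rw [h₃a] at f11
  have r₅ := reaches_exec (τ := τ) (Cmd.block [.op .mul 0 11 5, .op .mul 0 0 6])
    (by simp [Cmd.block, Cmd.LoopFree]) s₄ p'
  have hH := (hits_le_firstTrial (τ := τ) s.arr n (2 ^ ℓ) (2 ^ a) n).trans hS
  have hHL : hits τ s.arr n (2 ^ ℓ) (2 ^ a) n * 2 ^ ℓ ≤ 4 * n ^ 2 := by
    calc _ ≤ (2 * n) * (2 * n) := Nat.mul_le_mul hH hL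
      _ = _ := by ring
  have hHLN : hits τ s.arr n (2 ^ ℓ) (2 ^ a) n * 2 ^ ℓ * 2 ^ a ≤ 8 * n ^ 3 := by
    calc _ ≤ (4 * n ^ 2) * (2 * n) := Nat.mul_le_mul hHL hN
      _ = _ := by ring
  have hn3 : n ^ 3 < (n + 2) ^ 3 := Nat.pow_lt_pow_left (by omega) (by norm_num)
  have e2 := Nat.mod_eq_of_lt (hHL.trans_lt (show 4 * n ^ 2 < 2 ^ w by omega))
  have e3 := Nat.mod_eq_of_lt (hHLN.trans_lt (show 8 * n ^ 3 < 2 ^ w by omega))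
  refine ⟨_, _, (r₀.seq (r₁.seq (r₂.seq (r₃.seq (r₄.seq r₅))))).mono ?_, ?_, ?_⟩
  · simp [Cmd.block, Cmd.cost]
    omega
  · simp [Cmd.block, Cmd.exec, Memory.setReg, BinOp.eval, f11, g₄ 5, g₄ 6, g₃ 5, f5, f6, e2, e3]
  · intro h
    simpa [Cmd.block, Cmd.exec, Memory.setReg] using gF (f11 ▸ h)

theorem Reaches.haltsWith {w : ℕ} {τ : ℕ → Fin (2 ^ w)} {c : Cmd} {s s' : Memory} {B p' : ℕ}
    {Q : Memory → Prop} (h : Reaches w τ c s 0 B s' p') (hQ : Q s') : HaltsWith w c s τ Q := by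
  obtain ⟨k, -, h⟩ := h
  refine ⟨k, ?_, ?_⟩ <;> rw [run, h]
  exact hQ

theorem Reaches.haltTime_le {w : ℕ} {τ : ℕ → Fin (2 ^ w)} {c : Cmd} {s s' : Memory} {B p' : ℕ}
    (h : Reaches w τ c s 0 B s' p') : haltTime w c s τ ≤ B := by
  obtain ⟨k, hk, h⟩ := h
  refine (iInf₂_le k ?_).trans (by exact_mod_cast hk)
  rw [run, h]

/-! ### A lower bound for matrix multiplication -/

/-- Each step changes at most one memory cell. -/
theorem card_changed_le (w : ℕ) (τ : ℕ → Fin (2 ^ w)) (K : Config) (a i : ℕ) (S : Finset ℕ)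
    (h0 : ∀ p ∈ S, K.mem.arr a p = 0) (h1 : ∀ p ∈ S, ((step w τ)^[i] K).mem.arr a p ≠ 0) :
    S.card ≤ i := by
  classical
  induction i generalizing S with
  | zero =>
    rw [Finset.card_eq_zero.2]
    exact Finset.eq_empty_of_forall_notMem fun p hp => h1 p hp (h0 p hp)
  | succ i ih =>
    rw [Function.iterate_succ_apply'] at h1
    obtain ⟨q, hq⟩ : ∃ q, ∀ p, p ≠ q →
        (step w τ ((step w τ)^[i] K)).mem.arr a p = ((step w τ)^[i] K).mem.arr a p := by
      generalize (step w τ)^[i] K = K'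
      rcases K' with ⟨_ | ⟨c, l⟩, s, p⟩
      · exact ⟨0, fun _ _ => rfl⟩
      · cases c with
        | store b j x =>
          refine ⟨s.reg j, fun p hp => ?_⟩
          by_cases hb : a = b
          · subst hb
            simp [step, Memory.setArr, hp]
          · simp [step, Memory.setArr, hb]
        | _ => exact ⟨0, fun _ _ => rfl⟩
    have := ih (S.erase q) (fun p hp => h0 p (Finset.mem_of_mem_erase hp)) fun p hp => by
      rw [← hq p (Finset.ne_of_mem_erase hp)]
      exact h1 p (Finset.mem_of_mem_erase hp)
    have := Finset.pred_card_le_card_erase (s := S) (a := q)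
    omega

/-- The product of two all-ones `k × k` matrices has `k ^ 2` nonzero entries, each of which has to be
written by a step of its own. -/
theorem MatMulInTime.two_le {ω : ℝ} (h : MatMulInTime ω) : 2 ≤ ω := by
  obtain ⟨P, κ, C, h⟩ := h
  by_contra! hω
  have key : ∀ k : ℕ, 1 ≤ k → (k : ℝ) ^ (2 - ω) ≤ C := by
    intro k hk
    -- the entries of the product equal `k`, which must not vanish modulo `2 ^ w`
    obtain ⟨w, hw⟩ : ∃ w : ℕ, (k + 2) ^ κ + k + 2 < 2 ^ w := ⟨_, Nat.lt_two_pow_self⟩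
    obtain ⟨i, hi, -, hr⟩ := h k hk w (by omega) (.of fun _ _ => 1) (.of fun _ _ => 1)
      (fun _ => 0)
    have hcard := card_changed_le w (fun _ => 0)
      ⟨[P], matInput (.of fun _ _ => 1 : Matrix (Fin k) (Fin k) (ZMod (2 ^ w))) (.of fun _ _ => 1), 0⟩
      2 i (Finset.range (k ^ 2)) ?_ ?_
    · rw [Finset.card_range] at hcard
      have hk0 : (0 : ℝ) < k := by exact_mod_cast hk
      have h1 : (k : ℝ) ^ (2 : ℝ) ≤ C * (k : ℝ) ^ ω := by
        refine le_trans ?_ hi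
        rw [Real.rpow_two]
        exact_mod_cast hcard
      rwa [Real.rpow_sub hk0, div_le_iff₀ (by positivity)]
    · intro p _
      simp [matInput]
    · intro p hp
      rw [Finset.mem_range, pow_two] at hp
      have h1 : p / k < k := Nat.div_lt_of_lt_mul hp
      have h2 : p % k < k := Nat.mod_lt _ hk
      have h3 := hr ⟨p / k, h1⟩ ⟨p % k, h2⟩
      simp only [Nat.div_add_mod'] at h3
      rw [run] at h3
      rw [h3, Matrix.mul_apply]
      simp only [Matrix.of_apply, mul_one, Finset.sum_const, Finset.card_univ, Fintype.card_fin,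
        nsmul_eq_mul]
      rw [ZMod.val_natCast, Nat.mod_eq_of_lt (by omega)]
      omega
  have ht : Filter.Tendsto (fun k : ℕ => (k : ℝ) ^ (2 - ω)) Filter.atTop Filter.atTop :=
    (tendsto_rpow_atTop (by linarith)).comp tendsto_natCast_atTop_atTop
  obtain ⟨k, hk, hk'⟩ := ((ht.eventually_gt_atTop C).and (Filter.eventually_ge_atTop 1)).exists
  exact absurd (key k hk') (not_le.2 hk)

end WordRAM

/-! ### Random words and the success probability of the trials -/

/-- Summing over `r < L K` amounts to summing over the remainder and the quotient of `r` by `L`. -/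
theorem sum_range_mul_eq {M : Type*} [AddCommMonoid M] {L : ℕ} (hL : 0 < L) (K : ℕ)
    (f : ℕ → ℕ → M) :
    ∑ r ∈ Finset.range (L * K), f (r % L) (r / L) =
      ∑ k ∈ Finset.range K, ∑ o ∈ Finset.range L, f o k := by
  induction K with
  | zero => simp
  | succ K ih =>
    rw [Nat.mul_succ, Finset.sum_range_add, ih, Finset.sum_range_succ]
    congr 1
    refine Finset.sum_congr rfl fun o ho => ?_
    have ho := Finset.mem_range.1 ho
    rw [Nat.mul_add_mod, Nat.mod_eq_of_lt ho, Nat.mul_add_div hL, Nat.div_eq_of_lt ho, add_zero]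

theorem sum_range_mod_eq {M : Type*} [AddCommMonoid M] {N : ℕ} (hN : 0 < N) (Q : ℕ) (f : ℕ → M) :
    ∑ k ∈ Finset.range (N * Q), f (k % N) = Q • ∑ x ∈ Finset.range N, f x := by
  rw [sum_range_mul_eq hN Q fun o _ => f o]
  simp

namespace WordRAM

open ProbabilityTheory

instance (w : ℕ) : IsProbabilityMeasure (tapeMeasure w) := by
  unfold tapeMeasure
  infer_instance

theorem integral_tape {w : ℕ} (i : ℕ) (f : Fin (2 ^ w) → ℝ) :
    ∫ τ, f (τ i) ∂(tapeMeasure w) = (∑ r, f r) / 2 ^ w := by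
  have h := (measurePreserving_eval_infinitePi
    (fun _ : ℕ => (PMF.uniformOfFintype (Fin (2 ^ w))).toMeasure) i)
  have h2 := h.map_eq
  calc ∫ τ, f (τ i) ∂(tapeMeasure w)
      = ∫ r, f r ∂((tapeMeasure w).map (Function.eval i)) := by
        rw [integral_map h.measurable.aemeasurable (measurable_of_finite f).aestronglyMeasurable]
    _ = ∫ r, f r ∂(PMF.uniformOfFintype (Fin (2 ^ w))).toMeasure := by rw [tapeMeasure, h2]
    _ = _ := by
        rw [PMF.integral_eq_sum]
        simp [PMF.uniformOfFintype_apply, ← Finset.mul_sum]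
        ring

/-- Chebyshev's inequality for a sum of indicators that look at distinct random words: its variance
is at most its mean `E`. -/
theorem tape_chebyshev {ι : Type*} {w : ℕ} (S : Finset ι) (idx : ι → ℕ)
    (hidx : Set.InjOn idx S) (f : ι → ℕ → ℕ) (hf : ∀ q r, f q r ≤ 1) {E c : ℝ}
    (hE : (∑ q ∈ S, ∑ r : Fin (2 ^ w), (f q r : ℝ)) / 2 ^ w = E) (hc : 0 < c) :
    (tapeMeasure w).real {τ | c ≤ |((∑ q ∈ S, f q (τ (idx q)) : ℕ) : ℝ) - E|} ≤ E / c ^ 2 := by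
  set μ := tapeMeasure w with hμ
  set X : ι → (ℕ → Fin (2 ^ w)) → ℝ := fun q τ => (f q (τ (idx q)) : ℝ) with hX
  have hmeas : ∀ q, Measurable (X q) := fun q =>
    (measurable_of_finite fun r : Fin (2 ^ w) => (f q r : ℝ)).comp (measurable_pi_apply (idx q))
  have hbd : ∀ q τ, ‖X q τ‖ ≤ 1 := fun q τ => by
    simp only [hX, Real.norm_natCast]
    exact_mod_cast hf q _
  have hLp : ∀ q, MemLp (X q) 2 μ := fun q =>
    MemLp.of_bound (hmeas q).aestronglyMeasurable 1 (ae_of_all _ (hbd q))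
  have hint : ∀ q, Integrable (X q) μ := fun q => (hLp q).integrable (by norm_num)
  have hindep : iIndepFun (fun (i : ℕ) (τ : ℕ → Fin (2 ^ w)) => τ i) μ :=
    iIndepFun_infinitePi (P := fun _ : ℕ => (PMF.uniformOfFintype (Fin (2 ^ w))).toMeasure)
      (X := fun _ r => r) (fun _ => measurable_id)
  have hpair : Set.Pairwise (S : Set ι) fun q q' => X q ⟂ᵢ[μ] X q' := fun q hq q' hq' hne =>
    (hindep.indepFun fun h => hne (hidx hq hq' h)).comp
      (measurable_of_finite fun r : Fin (2 ^ w) => (f q r : ℝ))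
      (measurable_of_finite fun r : Fin (2 ^ w) => (f q' r : ℝ))
  have hexp : μ[∑ q ∈ S, X q] = E := by
    simp only [Finset.sum_apply]
    rw [integral_finsetSum _ fun q _ => hint q, ← hE, Finset.sum_div]
    exact Finset.sum_congr rfl fun q _ => integral_tape (idx q) fun r => (f q r : ℝ)
  have hvar : variance (∑ q ∈ S, X q) μ ≤ E := by
    rw [IndepFun.variance_sum (fun q _ => hLp q) hpair, ← hE, Finset.sum_div]
    refine Finset.sum_le_sum fun q _ => ?_
    refine (variance_le_expectation_sq (hmeas q).aestronglyMeasurable).trans_eq ?_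
    rw [← integral_tape (idx q) fun r => (f q r : ℝ)]
    refine integral_congr_ae (ae_of_all _ fun τ => ?_)
    -- indicators are idempotent
    have := hf q (τ (idx q))
    simp only [hX, Pi.pow_apply]
    interval_cases f q (τ (idx q)) <;> norm_num
  have := meas_ge_le_variance_div_sq (memLp_finsetSum' S fun q _ => hLp q) hc
  rw [hexp] at this
  have h2 := ENNReal.toReal_mono ENNReal.ofReal_ne_top this
  rw [ENNReal.toReal_ofReal (by have := variance_nonneg (∑ q ∈ S, X q) μ; positivity)] at h2
  refine le_trans (le_of_eq ?_) (h2.trans (by gcongr))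
  rw [Measure.real]
  simp [hX]

/-- The number of pairs of a trial of the scan and an outcome of its random word for which it
succeeds: every triple `u`, `i`, `x` is hit by exactly `Q` outcomes `r < L N Q` of the one trial
whose block contains the position `i`. -/
theorem sum_hit {arr : ℕ → ℕ → ℕ} {n L N Q : ℕ} (hL : 0 < L) (hN : 0 < N) (hn : n ≤ N) :
    ∑ q ∈ (Finset.range n).sigma fun u => Finset.range (blocks arr L u),
      ∑ r ∈ Finset.range (L * (N * Q)), hit arr n L N q.1 (q.2 * L) r =
    Q * ∑ u ∈ Finset.range n, ∑ i ∈ Finset.range (arr 1 u), ∑ x ∈ Finset.range n,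
      if u < arr 2 (u * n + i) ∧ arr 2 (u * n + i) < x ∧ arr 0 (u * n + x) = 1 ∧
        arr 0 (arr 2 (u * n + i) * n + x) = 1 then 1 else 0 := by
  rw [Finset.sum_sigma, Finset.mul_sum]
  refine Finset.sum_congr rfl fun u hu => ?_
  set h : ℕ → ℕ → ℕ := fun i x => if i < arr 1 u ∧ u < arr 2 (u * n + i) ∧
    arr 2 (u * n + i) < x ∧ x < n ∧ arr 0 (u * n + x) = 1 ∧
    arr 0 (arr 2 (u * n + i) * n + x) = 1 then 1 else 0 with hh
  have h1 : ∀ b, ∑ r ∈ Finset.range (L * (N * Q)), hit arr n L N u (b * L) r =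
      Q * ∑ o ∈ Finset.range L, ∑ x ∈ Finset.range N, h (b * L + o) x := fun b => by
    calc ∑ r ∈ Finset.range (L * (N * Q)), hit arr n L N u (b * L) r
        = ∑ r ∈ Finset.range (L * (N * Q)), h (b * L + r % L) (r / L % N) := rfl
      _ = ∑ k ∈ Finset.range (N * Q), ∑ o ∈ Finset.range L, h (b * L + o) (k % N) :=
          sum_range_mul_eq hL _ fun o k => h (b * L + o) (k % N)
      _ = Q • ∑ x ∈ Finset.range N, ∑ o ∈ Finset.range L, h (b * L + o) x :=
          sum_range_mod_eq hN Q fun x => ∑ o ∈ Finset.range L, h (b * L + o) x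
      _ = _ := by rw [Finset.sum_comm, smul_eq_mul]
  simp only [h1]
  rw [← Finset.mul_sum]
  congr 1
  have h2 := sum_range_mul_eq hL (blocks arr L u)
    fun o b => ∑ x ∈ Finset.range N, h (b * L + o) x
  rw [← h2]
  simp only [Nat.div_add_mod']
  have h3 : arr 1 u ≤ L * blocks arr L u := by
    rw [mul_comm]
    exact not_lt.1 fun hlt => lt_irrefl _ ((lt_blocks_iff hL).2 hlt)
  have h4 := Finset.sum_subset (f := fun i => ∑ x ∈ Finset.range N, h i x)
    (Finset.range_mono h3) fun i _ hi => by
      refine Finset.sum_eq_zero fun x _ => if_neg fun hc => hi (Finset.mem_range.2 hc.1)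
  rw [← h4]
  refine Finset.sum_congr rfl fun i hi => ?_
  have h5 := Finset.sum_subset (f := fun x => h i x) (Finset.range_mono hn) fun x _ hx =>
    if_neg fun hc => hx (Finset.mem_range.2 hc.2.2.2.1)
  rw [← h5]
  refine Finset.sum_congr rfl fun x hx => ?_
  simp only [hh, Finset.mem_range.1 hi, Finset.mem_range.1 hx, true_and]

/-- Different trials use different random words. -/
theorem firstTrial_add_injOn (arr : ℕ → ℕ → ℕ) (n L : ℕ) :
    Set.InjOn (fun q : (_ : ℕ) × ℕ => firstTrial arr L q.1 + q.2)
      ((Finset.range n).sigma fun u => Finset.range (blocks arr L u)) := by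
  have key : ∀ u b u' b', b < blocks arr L u → u < u' →
      firstTrial arr L u + b < firstTrial arr L u' + b' := by
    intro u b u' b' hb hu
    have h1 := firstTrial_mono arr L (Nat.succ_le_of_lt hu)
    have h2 : firstTrial arr L (u + 1) = firstTrial arr L u + blocks arr L u :=
      Finset.sum_range_succ _ _
    simp only [Nat.succ_eq_add_one] at h1
    omega
  rintro ⟨u, b⟩ hq ⟨u', b'⟩ hq' heq
  simp only [Finset.coe_sigma, Set.mem_sigma_iff, Finset.coe_range, Set.mem_Iio] at hq hq' heq
  rcases lt_trichotomy u u' with h | rfl | h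
  · have := key u b u' b' hq.2 h
    omega
  · simp only [add_right_inj] at heq
    rw [heq]
  · have := key u' b' u b hq'.2 h
    omega

theorem hits_eq_sum {w : ℕ} (τ : ℕ → Fin (2 ^ w)) (arr : ℕ → ℕ → ℕ) (n L N : ℕ) :
    hits τ arr n L N n = ∑ q ∈ (Finset.range n).sigma fun u => Finset.range (blocks arr L u),
      hit arr n L N q.1 (q.2 * L) (τ (firstTrial arr L q.1 + q.2)) := by
  rw [Finset.sum_sigma]
  rfl

section Graph

variable {n : ℕ} (G : SimpleGraph (Fin n)) [DecidableRel G.Adj]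
  (nbr : (u : Fin n) → Fin (G.degree u) ≃ G.neighborSet u)

theorem div_mod_aux {n : ℕ} (u x : Fin n) : ((u : ℕ) * n + x) / n = u ∧
    ((u : ℕ) * n + x) % n = x := by
  have hn : 0 < n := u.pos
  constructor
  · rw [mul_comm, Nat.mul_add_div hn, Nat.div_eq_of_lt x.isLt, add_zero]
  · rw [mul_comm, Nat.mul_add_mod, Nat.mod_eq_of_lt x.isLt]

theorem graphInput_adj (u x : Fin n) :
    (graphInput G nbr).arr 0 (u * n + x) = if G.Adj u x then 1 else 0 := by
  obtain ⟨h1, h2⟩ := div_mod_aux u x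
  simp [graphInput, h1, h2]

theorem graphInput_degree (u : Fin n) : (graphInput G nbr).arr 1 u = G.degree u := by
  simp [graphInput]

theorem graphInput_nbr (u : Fin n) (i : Fin (G.degree u)) :
    (graphInput G nbr).arr 2 (u * n + i) = ((nbr u i : Fin n) : ℕ) := by
  have hi : (i : ℕ) < n := by
    have := G.degree_lt_card_verts u
    rw [Fintype.card_fin] at this
    omega
  obtain ⟨h1, h2⟩ := div_mod_aux u ⟨i, hi⟩
  have key : ∀ (u' : Fin n) (j : ℕ), u' = u → j = i →
      (if h : j < G.degree u' then ((nbr u' ⟨j, h⟩ : Fin n) : ℕ) else 0) = (nbr u i : Fin n) := by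
    rintro _ _ rfl rfl
    simp
  simp only [graphInput, OfNat.ofNat_ne_zero, OfNat.ofNat_ne_one, if_false, if_true]
  rw [dif_pos (show ((u : ℕ) * n + i) / n < n from h1.trans_lt u.isLt)]
  exact key _ _ (Fin.ext h1) h2

theorem graphInput_tame {w : ℕ} (hn : 1 ≤ n) (hw : (n + 2) ^ 6 ≤ 2 ^ w) :
    Tame w (graphInput G nbr).arr n where
  pos := hn
  matrix p := by
    simp only [graphInput]
    split_ifs <;> simp_all
  degree p := by
    have h : ∀ u, G.degree u ≤ n := fun u => by
      have := G.degree_lt_card_verts u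
      rw [Fintype.card_fin] at this
      omega
    simp only [graphInput]
    split_ifs <;> simp_all
  list p := by
    simp only [graphInput]
    split_ifs <;> first | omega | exact Fin.isLt _ | simp_all
  word := hw

theorem sum_degree_eq :
    ∑ u ∈ Finset.range n, (graphInput G nbr).arr 1 u = 2 * numEdges G := by
  rw [numEdges, ← G.sum_degrees_eq_twice_card_edges, ← Fin.sum_univ_eq_sum_range]
  exact Finset.sum_congr rfl fun u _ => graphInput_degree G nbr u

/-- Every triangle is counted once as an increasing triple of vertices. -/
theorem card_orderedTriangles :
    (Finset.univ.filter fun t : Fin n × Fin n × Fin n => t.1 < t.2.1 ∧ t.2.1 < t.2.2 ∧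
      G.Adj t.1 t.2.1 ∧ G.Adj t.1 t.2.2 ∧ G.Adj t.2.1 t.2.2).card = numTriangles G := by
  refine Finset.card_nbij (fun t => {t.1, t.2.1, t.2.2}) ?_ ?_ ?_
  · rintro ⟨u, v, x⟩ h
    simp only [Finset.coe_filter, Finset.mem_univ, true_and, Set.mem_ofPred_eq] at h
    rw [Finset.mem_coe, SimpleGraph.mem_cliqueFinset_iff, SimpleGraph.is3Clique_triple_iff]
    exact ⟨h.2.2.1, h.2.2.2.1, h.2.2.2.2⟩
  · rintro ⟨u, v, x⟩ h ⟨u', v', x'⟩ h' heq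
    simp only [Finset.coe_filter, Finset.mem_univ, true_and, Set.mem_ofPred_eq] at h h' heq
    obtain ⟨h1, h2, -⟩ := h
    obtain ⟨h1', h2', -⟩ := h'
    have hm : ∀ z, z = u ∨ z = v ∨ z = x ↔ z = u' ∨ z = v' ∨ z = x' := fun z => by
      simpa using Finset.ext_iff.1 heq z
    have a1 := (hm u).1 (by simp)
    have a2 := (hm v).1 (by simp)
    have a3 := (hm x).1 (by simp)
    simp only [Prod.mk.injEq]
    omega
  · intro s hs
    rw [Finset.mem_coe, SimpleGraph.mem_cliqueFinset_iff, SimpleGraph.is3Clique_iff] at hs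
    obtain ⟨a, b, c, hab, hac, hbc, rfl⟩ := hs
    have key : ∀ u v x : Fin n, G.Adj u v → G.Adj u x → G.Adj v x → u < v → v < x →
        ({u, v, x} : Finset (Fin n)) ∈ (fun t : Fin n × Fin n × Fin n =>
          ({t.1, t.2.1, t.2.2} : Finset (Fin n))) '' ((Finset.univ.filter
          fun t : Fin n × Fin n × Fin n => t.1 < t.2.1 ∧ t.2.1 < t.2.2 ∧
      G.Adj t.1 t.2.1 ∧ G.Adj t.1 t.2.2 ∧ G.Adj t.2.1 t.2.2 : Finset _) : Set _) :=
      fun u v x h1 h2 h3 h4 h5 => ⟨(u, v, x), by simp [*], rfl⟩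
    have p1 : ({a, c, b} : Finset (Fin n)) = {a, b, c} := by ext; simp; tauto
    have p2 : ({b, a, c} : Finset (Fin n)) = {a, b, c} := by ext; simp; tauto
    have p3 : ({b, c, a} : Finset (Fin n)) = {a, b, c} := by ext; simp; tauto
    have p4 : ({c, a, b} : Finset (Fin n)) = {a, b, c} := by ext; simp; tauto
    have p5 : ({c, b, a} : Finset (Fin n)) = {a, b, c} := by ext; simp; tauto
    rcases hab.ne.lt_or_gt with h1 | h1 <;> rcases hbc.ne.lt_or_gt with h2 | h2 <;>
      rcases hac.ne.lt_or_gt with h3 | h3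
    · exact key a b c hab hac hbc h1 h2
    · exact absurd (h1.trans h2) h3.asymm
    · exact p1 ▸ key a c b hac hab hbc.symm h3 h2
    · exact p4 ▸ key c a b hac.symm hbc.symm hab h3 h1
    · exact p2 ▸ key b a c hab.symm hbc hac h1 h3
    · exact p3 ▸ key b c a hbc hab.symm hac.symm h2 h3
    · exact absurd (h2.trans h1) h3.asymm
    · exact p5 ▸ key c b a hbc.symm hac.symm hab.symm h2 h1

theorem sum_graphInput_eq :
    (∑ u ∈ Finset.range n, ∑ i ∈ Finset.range ((graphInput G nbr).arr 1 u),
      ∑ x ∈ Finset.range n,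
      if u < (graphInput G nbr).arr 2 (u * n + i) ∧ (graphInput G nbr).arr 2 (u * n + i) < x ∧
        (graphInput G nbr).arr 0 (u * n + x) = 1 ∧
        (graphInput G nbr).arr 0 ((graphInput G nbr).arr 2 (u * n + i) * n + x) = 1
        then 1 else 0) = numTriangles G := by
  classical
  rw [← card_orderedTriangles, Finset.card_filter, Fintype.sum_prod_type,
    ← Fin.sum_univ_eq_sum_range]
  refine Finset.sum_congr rfl fun u _ => ?_
  rw [Fintype.sum_prod_type, graphInput_degree, ← Fin.sum_univ_eq_sum_range]
  simp only [graphInput_nbr, ← Fin.sum_univ_eq_sum_range, graphInput_adj]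
  rw [Equiv.sum_comp (nbr u) fun v : G.neighborSet u => ∑ x : Fin n,
    if (u : ℕ) < (v : Fin n) ∧ ((v : Fin n) : ℕ) < x ∧ (if G.Adj u x then 1 else 0) = 1 ∧
      (if G.Adj v x then 1 else 0) = 1 then 1 else 0]
  rw [← Finset.sum_subtype (Finset.univ.filter fun v => G.Adj u v)
    (p := fun v => v ∈ G.neighborSet u) (fun v => by simp) fun v => ∑ x : Fin n,
    if (u : ℕ) < v ∧ (v : ℕ) < x ∧ (if G.Adj u x then 1 else 0) = 1 ∧
      (if G.Adj v x then 1 else 0) = 1 then 1 else 0, Finset.sum_filter]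
  refine Finset.sum_congr rfl fun v _ => ?_
  by_cases h : G.Adj u v
  · simp [h]
  · simp [h]

end Graph

/-! ### The algorithm on a graph -/

theorem exists_least_pow {y a : ℕ} (hy : 0 < y) :
    ∃ ℓ, (∀ i < ℓ, 2 ^ i * y < a) ∧ a ≤ 2 ^ ℓ * y := by
  have h : ∃ ℓ, a ≤ 2 ^ ℓ * y :=
    ⟨a, (Nat.lt_two_pow_self (n := a)).le.trans (Nat.le_mul_of_pos_right _ hy)⟩
  exact ⟨Nat.find h, fun i hi => not_le.1 (Nat.find_min h hi), Nat.find_spec h⟩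

section Graph

variable {n : ℕ} (G : SimpleGraph (Fin n)) [DecidableRel G.Adj]
  (nbr : (u : Fin n) → Fin (G.degree u) ≃ G.neighborSet u)

/-- On every tape, the program halts within `300 n` steps, and its estimate is the number of
successful trials times `L N`; a success provides a triangle. -/
theorem mainProg_graph {w : ℕ} (hn : 1 ≤ n) (hw : (n + 2) ^ 6 ≤ 2 ^ w) :
    ∃ L N Q : ℕ, 0 < L ∧ n ≤ N ∧ 2 ^ w = L * (N * Q) ∧
      L * N ≤ 2 * n + 8 * numEdges G ∧ ∀ τ : ℕ → Fin (2 ^ w),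
      ∃ s' p', Reaches w τ mainProg (graphInput G nbr) 0 (300 * n) s' p' ∧
        s'.reg 0 = hits τ (graphInput G nbr).arr n L N n * (L * N) ∧
        (0 < hits τ (graphInput G nbr).arr n L N n → ∃ u v x : Fin n, s'.reg 1 = u ∧
          s'.reg 2 = v ∧ s'.reg 3 = x ∧ G.Adj u v ∧ G.Adj v x ∧ G.Adj u x) := by
  have ht := graphInput_tame G nbr hn hw
  have hM := sum_degree_eq G nbr
  obtain ⟨ℓ, hℓ, hℓ'⟩ := exists_least_pow (y := n) (a := 2 * numEdges G) hn
  obtain ⟨a, ha, ha'⟩ := exists_least_pow (y := 1) (a := n) one_pos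
  simp only [mul_one] at ha ha'
  have hMn : 2 * numEdges G ≤ n * n := by
    rw [← hM]
    calc _ ≤ ∑ u ∈ Finset.range n, n := Finset.sum_le_sum fun u _ => ht.degree u
      _ = n * n := by simp
  obtain ⟨hL, -⟩ := pow_le_two_mul hn hMn hℓ
  obtain ⟨hN, -⟩ := pow_le_two_mul (y := 1) (M := n) hn (by simp) (by simpa using ha)
  -- `L N` divides the number of words, so `r % L` and `r / L % N` are uniform and independent
  have hlt : ℓ + a ≤ w := by
    refine (Nat.pow_le_pow_iff_right (a := 2) (by norm_num)).1 ?_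
    have h1 : 2 ^ (ℓ + a) ≤ (2 * n) * (2 * n) := by
      rw [pow_add]
      exact Nat.mul_le_mul hL hN
    have h2 := ht.cube
    nlinarith [sq_nonneg n, pow_pos (show 0 < n by omega) 3]
  refine ⟨2 ^ ℓ, 2 ^ a, 2 ^ (w - (ℓ + a)), by positivity, ha', ?_, ?_, fun τ => ?_⟩
  · rw [← mul_assoc, ← pow_add, ← pow_add]
    congr 1
    omega
  · rcases ℓ with _ | i
    · simp
      omega
    · have h1 := hℓ i (by omega)
      rw [pow_succ]
      nlinarith [Nat.mul_le_mul_left (2 ^ i * 2) hN]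
  · set F : ℕ → ℕ → ℕ → Prop := fun p q r => ∃ u v x : Fin n, p = u ∧ q = v ∧ r = x ∧
      G.Adj u v ∧ G.Adj v x ∧ G.Adj u x with hFdef
    have hF : ∀ u < n, ∀ j r, hit (graphInput G nbr).arr n (2 ^ ℓ) (2 ^ a) u j r = 1 →
        F u ((graphInput G nbr).arr 2 (u * n + (j + r % 2 ^ ℓ))) (r / 2 ^ ℓ % 2 ^ a) := by
      intro u hu j r h1
      unfold hit at h1
      split_ifs at h1 with h
      obtain ⟨hi, -, -, hx, hux, hvx⟩ := h
      generalize j + r % 2 ^ ℓ = i at *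
      generalize r / 2 ^ ℓ % 2 ^ a = x at *
      obtain ⟨u, rfl⟩ : ∃ u' : Fin n, (u' : ℕ) = u := ⟨⟨u, hu⟩, rfl⟩
      obtain ⟨x, rfl⟩ : ∃ x' : Fin n, (x' : ℕ) = x := ⟨⟨x, hx⟩, rfl⟩
      rw [graphInput_degree] at hi
      have hv := graphInput_nbr G nbr u ⟨i, hi⟩
      simp only at hv
      rw [hv] at hvx ⊢
      rw [graphInput_adj] at hux hvx
      refine ⟨u, nbr u ⟨i, hi⟩, x, rfl, rfl, rfl, (nbr u ⟨i, hi⟩).2, ?_, ?_⟩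
      · by_contra h
        simp [h] at hvx
      · by_contra h
        simp [h] at hux
    obtain ⟨s', p', hr, h0, hF'⟩ := mainProg_spec (τ := τ) (s := graphInput G nbr) (n := n)
      (F := F) ht (fun x => rfl) (hM ▸ hℓ) (hM ▸ hℓ') ha ha' hF
    exact ⟨s', p', hr, by rw [h0, mul_assoc], hF'⟩

theorem mainProg_expectedTime {w : ℕ} (hn : 1 ≤ n) (hw : (n + 2) ^ 6 ≤ 2 ^ w) :
    expectedTime w mainProg (graphInput G nbr) ≤ ENNReal.ofReal (300 * n) := by
  obtain ⟨L, N, Q, -, -, -, -, h⟩ := mainProg_graph G nbr hn hw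
  have : ∀ τ, haltTime w mainProg (graphInput G nbr) τ ≤ ENNReal.ofReal (300 * n) := fun τ => by
    obtain ⟨s', p', hr, -⟩ := h τ
    refine hr.haltTime_le.trans_eq ?_
    rw [← ENNReal.ofReal_natCast]
    push_cast
    rfl
  calc expectedTime w mainProg (graphInput G nbr)
      ≤ ∫⁻ _, ENNReal.ofReal (300 * n) ∂(tapeMeasure w) := lintegral_mono this
    _ = _ := by simp

/-- Chebyshev's inequality for the estimator, whose relative variance is at most `L N / t`. -/
theorem mainProg_successProb {w : ℕ} (hn : 1 ≤ n) (hw : (n + 2) ^ 6 ≤ 2 ^ w)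
    (ht : 0 < numTriangles G) {ε : ℝ} (hε : 0 < ε) (hε' : ε < 1) :
    1 - (2 * n + 8 * numEdges G : ℝ) / (ε ^ 2 * numTriangles G) ≤
      successProb w mainProg (graphInput G nbr) (GoodOutput G ε) := by
  obtain ⟨L, N, Q, hL, hN, hW, hLN, h⟩ := mainProg_graph G nbr hn hw
  have hN0 : 0 < N := by omega
  have hQ0 : 0 < Q := by
    rcases Nat.eq_zero_or_pos Q with rfl | h
    · simp at hW
    · exact h
  set arr := (graphInput G nbr).arr with harr
  set t := numTriangles G with htt
  have hL' : (0 : ℝ) < L := by exact_mod_cast hL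
  have hN' : (0 : ℝ) < N := by exact_mod_cast hN0
  have hQ' : (0 : ℝ) < Q := by exact_mod_cast hQ0
  have ht' : (0 : ℝ) < t := by exact_mod_cast ht
  have hW' : (2 : ℝ) ^ w = L * (N * Q) := by exact_mod_cast hW
  have hcount := sum_hit (arr := arr) (n := n) (L := L) (N := N) (Q := Q) hL hN0 hN
  rw [← hW, sum_graphInput_eq, ← htt] at hcount
  have hE : (∑ q ∈ (Finset.range n).sigma fun u => Finset.range (blocks arr L u),
      ∑ r : Fin (2 ^ w), (hit arr n L N q.1 (q.2 * L) r : ℝ)) / 2 ^ w = t / (L * N) := by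
    have : ∀ q : (_ : ℕ) × ℕ, ∑ r : Fin (2 ^ w), (hit arr n L N q.1 (q.2 * L) r : ℝ) =
        ((∑ r ∈ Finset.range (2 ^ w), hit arr n L N q.1 (q.2 * L) r : ℕ) : ℝ) := fun q => by
      rw [Nat.cast_sum, ← Fin.sum_univ_eq_sum_range fun r => (hit arr n L N q.1 (q.2 * L) r : ℝ)]
    simp only [this]
    rw [← Nat.cast_sum, hcount, hW']
    push_cast
    field_simp
  have hcheb := tape_chebyshev ((Finset.range n).sigma fun u => Finset.range (blocks arr L u))
    (fun q => firstTrial arr L q.1 + q.2) (firstTrial_add_injOn arr n L)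
    (fun q r => hit arr n L N q.1 (q.2 * L) r) (fun q r => hit_le_one _ _ _ _ _ _ _) hE
    (c := ε * (t / (L * N))) (by positivity)
  simp only [← hits_eq_sum] at hcheb
  set bad : Set (ℕ → Fin (2 ^ w)) :=
    {τ | ε * (t / (L * N)) ≤ |(hits τ arr n L N n : ℝ) - t / (L * N)|} with hbad
  have hmeas : MeasurableSet bad := by
    have : Measurable fun τ : ℕ → Fin (2 ^ w) => (hits τ arr n L N n : ℝ) := by
      simp only [hits_eq_sum, Nat.cast_sum]
      refine Finset.measurable_sum _ fun q _ => ?_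
      exact (measurable_of_finite fun r : Fin (2 ^ w) =>
        (hit arr n L N q.1 (q.2 * L) r : ℝ)).comp (measurable_pi_apply _)
    exact measurableSet_le measurable_const (this.sub_const _).abs
  have hsub : badᶜ ⊆ {τ | HaltsWith w mainProg (graphInput G nbr) τ (GoodOutput G ε)} := by
    intro τ hτ
    obtain ⟨s', p', hr, h0, hF⟩ := h τ
    simp only [hbad, Set.mem_compl_iff, Set.mem_ofPred_eq, not_le, abs_lt] at hτ
    obtain ⟨E, hEE⟩ : ∃ E : ℝ, (t / (L * N) : ℝ) = E := ⟨_, rfl⟩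
    rw [hEE] at hτ
    have hEpos : 0 < E := hEE ▸ by positivity
    have htE : (t : ℝ) = E * (L * N) := by
      rw [← hEE]
      field_simp
    refine hr.haltsWith ⟨?_, hF ?_⟩
    · rw [h0, ← htt, htE]
      push_cast
      have hLN0 : (0 : ℝ) < L * N := by positivity
      constructor
      · rw [← mul_assoc]
        exact mul_le_mul_of_nonneg_right (by linarith [hτ.1]) hLN0.le
      · rw [← mul_assoc (1 + ε)]
        exact mul_le_mul_of_nonneg_right (by linarith [hτ.2]) hLN0.le
    · have : (0 : ℝ) < hits τ arr n L N n := by nlinarith [hτ.1]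
      exact_mod_cast this
  calc 1 - (2 * n + 8 * numEdges G : ℝ) / (ε ^ 2 * t)
      ≤ 1 - (t / (L * N)) / (ε * (t / (L * N))) ^ 2 := by
        have h1 : (t / (L * N) : ℝ) / (ε * (t / (L * N))) ^ 2 = L * N / (ε ^ 2 * t) := by
          field_simp
        rw [h1]
        have : (L * N : ℝ) ≤ 2 * n + 8 * numEdges G := by exact_mod_cast hLN
        gcongr
    _ ≤ 1 - (tapeMeasure w).real bad := by linarith
    _ = (tapeMeasure w).real badᶜ := (probReal_compl_eq_one_sub hmeas).symm
    _ ≤ _ := measureReal_mono hsub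

end Graph

/-- Both time bounds are at least linear. -/
theorem linear_le_time {δ ω c₁ : ℝ} (hδ0 : 0 < δ) (hδ : δ ≤ 1 / 4) (hω : 2 ≤ ω) (hc₁ : 0 < c₁)
    {T : ℕ → ℕ → ℝ} (hT : T = (fun (n _ : ℕ) => (n : ℝ) ^ (ω * (1 - δ))) ∨
      T = (fun (n m : ℕ) => ((m : ℝ) * (n : ℝ) ^ (-2 * δ)) ^ (2 * ω / (ω + 1)))) :
    ∃ K : ℝ, 0 < K ∧ ∀ n m : ℕ, 1 ≤ n → c₁ * (n : ℝ) ^ (1 + 3.82 * δ) ≤ m →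
      (n : ℝ) ≤ K * T n m := by
  rcases hT with rfl | rfl
  · refine ⟨1, one_pos, fun n m hn _ => ?_⟩
    have hn' : (1 : ℝ) ≤ n := by exact_mod_cast hn
    rw [one_mul]
    calc (n : ℝ) = (n : ℝ) ^ (1 : ℝ) := (Real.rpow_one _).symm
      _ ≤ _ := Real.rpow_le_rpow_of_exponent_le hn' (by nlinarith)
  · set e := 2 * ω / (ω + 1) with he
    have he1 : 1 ≤ e := by
      rw [he, le_div_iff₀ (by linarith)]
      linarith
    refine ⟨(c₁ ^ e)⁻¹, by positivity, fun n m hn hm => ?_⟩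
    have hn' : (1 : ℝ) ≤ n := by exact_mod_cast hn
    have hn0 : (0 : ℝ) < n := by linarith
    have h1 : c₁ * (n : ℝ) ≤ m * (n : ℝ) ^ (-2 * δ) := by
      calc c₁ * (n : ℝ) = c₁ * (n : ℝ) ^ (1 : ℝ) := by rw [Real.rpow_one]
        _ ≤ c₁ * (n : ℝ) ^ (1 + 3.82 * δ + -2 * δ) := by
          exact mul_le_mul_of_nonneg_left
            (Real.rpow_le_rpow_of_exponent_le hn' (by linarith)) hc₁.le
        _ = c₁ * (n : ℝ) ^ (1 + 3.82 * δ) * (n : ℝ) ^ (-2 * δ) := by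
          rw [Real.rpow_add hn0, mul_assoc]
        _ ≤ _ := by gcongr
    rw [← div_eq_inv_mul, le_div_iff₀ (by positivity), mul_comm]
    calc c₁ ^ e * n = c₁ ^ e * (n : ℝ) ^ (1 : ℝ) := by rw [Real.rpow_one]
      _ ≤ c₁ ^ e * (n : ℝ) ^ e := by
        exact mul_le_mul_of_nonneg_left (Real.rpow_le_rpow_of_exponent_le hn' he1) (by positivity)
      _ = (c₁ * n) ^ e := (Real.mul_rpow hc₁.le hn0.le).symm
      _ ≤ _ := Real.rpow_le_rpow (by positivity) h1 (by linarith)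

/-- The ratio `m / t` governs both relative variances.  The exponent `β` is a parameter because the
algorithm only needs `m ≥ c₁ n`. -/
theorem edges_div_triangles_le {δ c₁ c₂ n m t : ℝ} (hδ0 : 0 < δ) (hc₁ : 0 < c₁) (hc₂ : 0 < c₂)
    (hn : 1 ≤ n) {β : ℝ} (hm : c₁ * n ^ β ≤ m) (ht : c₂ * m ^ (1 + δ) ≤ t) :
    0 < m ∧ 0 < t ∧ m / t ≤ (c₂ * c₁ ^ δ)⁻¹ * n ^ (-(β * δ)) := by
  have hn0 : 0 < n := by linarith
  have hm0 : 0 < m := lt_of_lt_of_le (by positivity) hm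
  have ht0 : 0 < t := lt_of_lt_of_le (by positivity) ht
  refine ⟨hm0, ht0, ?_⟩
  have h1 : c₂ * m * (c₁ ^ δ * n ^ (β * δ)) ≤ t := by
    refine le_trans ?_ ht
    rw [Real.rpow_add hm0, Real.rpow_one, mul_assoc]
    gcongr
    calc c₁ ^ δ * n ^ (β * δ) = (c₁ * n ^ β) ^ δ := by
          rw [Real.mul_rpow hc₁.le (by positivity), ← Real.rpow_mul hn0.le]
      _ ≤ m ^ δ := by gcongr
  rw [Real.rpow_neg hn0.le, ← mul_inv, div_le_iff₀ ht0, ← div_eq_inv_mul,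
    le_div_iff₀ (by positivity)]
  linarith

end WordRAM

/-! ### Sampling vertices -/

section Sampling

variable {n : ℕ}

/-- A set `S` survives the sampling with probability `p ^ |S|`. -/
theorem sum_weight_superset (p : ℝ) (S : Finset (Fin n)) :
    ∑ U : Finset (Fin n), (if S ⊆ U then p ^ U.card * (1 - p) ^ (n - U.card) else 0) =
      p ^ S.card := by
  have h := Finset.prod_add (fun _ : Fin n => p) (fun i => if i ∈ S then 0 else 1 - p) Finset.univ
  have h1 : ∏ i : Fin n, (p + if i ∈ S then 0 else 1 - p) = p ^ S.card := by
    calc ∏ i : Fin n, (p + if i ∈ S then 0 else 1 - p)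
        = ∏ i : Fin n, if i ∈ S then p else 1 := Finset.prod_congr rfl fun i _ => by
          split_ifs <;> ring
      _ = p ^ S.card := by
          rw [Finset.prod_ite_mem, Finset.univ_inter, Finset.prod_const]
  rw [← h1, h, Finset.powerset_univ]
  refine Finset.sum_congr rfl fun U _ => ?_
  rw [Finset.prod_const]
  split_ifs with hS
  · congr 1
    rw [Finset.prod_congr rfl fun i hi => if_neg fun hi' => (Finset.mem_sdiff.1 hi).2 (hS hi'),
      Finset.prod_const, Finset.card_sdiff_of_subset (Finset.subset_univ _), Finset.card_univ,
      Fintype.card_fin]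
  · obtain ⟨i, hi, hiU⟩ := Finset.not_subset.1 hS
    rw [Finset.prod_eq_zero (i := i) (by simp [hiU]) (by simp [hi]), mul_zero]

theorem sampleProb_eq_one_sub (p : ℝ) (Q : Finset (Fin n) → Prop) [DecidablePred Q] :
    sampleProb n p Q = 1 - ∑ U ∈ Finset.univ.filter (fun U => ¬ Q U),
      p ^ U.card * (1 - p) ^ (n - U.card) := by
  have h1 : ∑ U : Finset (Fin n), p ^ U.card * (1 - p) ^ (n - U.card) = 1 := by
    simpa using sum_weight_superset p (∅ : Finset (Fin n))
  rw [eq_sub_iff_add_eq]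
  refine Eq.trans ?_ h1
  rw [← Finset.sum_filter_add_sum_filter_not Finset.univ Q, sampleProb]
  congr 1
  refine Finset.sum_congr ?_ fun _ _ => rfl
  ext
  simp

/-- The variance of the number of sampled triples of a family, as a sum over pairs of triples. -/
theorem sum_weight_sq (p : ℝ) (F : Finset (Finset (Fin n))) (hF : ∀ T ∈ F, T.card = 3) :
    ∑ U : Finset (Fin n), p ^ U.card * (1 - p) ^ (n - U.card) *
      (((F.filter fun T => T ⊆ U).card : ℝ) - F.card * p ^ 3) ^ 2 =
      ∑ T ∈ F, ∑ T' ∈ F, (p ^ (T ∪ T').card - p ^ 6) := by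
  set W : Finset (Fin n) → ℝ := fun U => p ^ U.card * (1 - p) ^ (n - U.card) with hW
  have h0 : ∑ U, W U = 1 := by simpa using sum_weight_superset p (∅ : Finset (Fin n))
  have hZ : ∀ U, ((F.filter fun T => T ⊆ U).card : ℝ) = ∑ T ∈ F, if T ⊆ U then 1 else 0 :=
    fun U => by simp
  have h1 : ∑ U, W U * ((F.filter fun T => T ⊆ U).card : ℝ) = F.card * p ^ 3 := by
    simp only [hZ, Finset.mul_sum]
    rw [Finset.sum_comm]
    simp only [mul_ite, mul_one, mul_zero, hW, sum_weight_superset]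
    rw [Finset.sum_congr rfl fun T hT => by rw [hF T hT]]
    simp
  have h2 : ∑ U, W U * ((F.filter fun T => T ⊆ U).card : ℝ) ^ 2 =
      ∑ T ∈ F, ∑ T' ∈ F, p ^ (T ∪ T').card := by
    simp only [hZ, sq, Finset.sum_mul_sum]
    simp only [Finset.mul_sum]
    rw [Finset.sum_comm]
    refine Finset.sum_congr rfl fun T _ => ?_
    rw [Finset.sum_comm]
    refine Finset.sum_congr rfl fun T' _ => ?_
    rw [← sum_weight_superset p (T ∪ T')]
    refine Finset.sum_congr rfl fun U _ => ?_
    by_cases hT : T ⊆ U <;> by_cases hT' : T' ⊆ U <;> simp [hT, hT', Finset.union_subset_iff, hW]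
  calc ∑ U, W U * (((F.filter fun T => T ⊆ U).card : ℝ) - F.card * p ^ 3) ^ 2
      = ∑ U, W U * ((F.filter fun T => T ⊆ U).card : ℝ) ^ 2 -
          2 * (F.card * p ^ 3) * ∑ U, W U * ((F.filter fun T => T ⊆ U).card : ℝ) +
          (F.card * p ^ 3) ^ 2 * ∑ U, W U := by
        rw [Finset.mul_sum, Finset.mul_sum, ← Finset.sum_sub_distrib, ← Finset.sum_add_distrib]
        exact Finset.sum_congr rfl fun U _ => by ring
    _ = _ := by
        rw [h0, h1, h2]
        simp only [Finset.sum_sub_distrib, Finset.sum_const, nsmul_eq_mul]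
        ring

variable (G : SimpleGraph (Fin n)) [DecidableRel G.Adj]

/-- A vertex lies in at most `m` triangles: the opposite edge determines the triangle. -/
theorem card_triangles_mem_le (v : Fin n) :
    ((G.cliqueFinset 3).filter fun T => v ∈ T).card ≤ numEdges G := by
  refine (Finset.card_le_card (t := G.edgeFinset.image fun e => insert v e.toFinset) ?_).trans
    Finset.card_image_le
  intro T hT
  rw [Finset.mem_filter, SimpleGraph.mem_cliqueFinset_iff, SimpleGraph.is3Clique_iff] at hT
  obtain ⟨⟨a, b, c, hab, hac, hbc, rfl⟩, hv⟩ := hT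
  simp only [Finset.mem_insert, Finset.mem_singleton] at hv
  rw [Finset.mem_image]
  rcases hv with rfl | rfl | rfl
  · exact ⟨s(b, c), by simpa using hbc, by ext; simp⟩
  · exact ⟨s(a, c), by simpa using hac, by ext; simp; tauto⟩
  · exact ⟨s(a, b), by simpa using hab, by ext; simp; tauto⟩

/-- An edge lies in at most `n` triangles: the third vertex determines the triangle. -/
theorem card_triangles_superset_le (e : Finset (Fin n)) (he : e.card = 2) :
    ((G.cliqueFinset 3).filter fun T => e ⊆ T).card ≤ n := by
  refine (Finset.card_le_card (t := Finset.univ.image fun x => insert x e) ?_).trans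
    (Finset.card_image_le.trans (by simp))
  intro T hT
  rw [Finset.mem_filter, SimpleGraph.mem_cliqueFinset_iff] at hT
  obtain ⟨hT, heT⟩ := hT
  have h1 : (T \ e).card = 1 := by
    rw [Finset.card_sdiff_of_subset heT, hT.card_eq, he]
  obtain ⟨x, hx⟩ := Finset.card_eq_one.1 h1
  refine Finset.mem_image.2 ⟨x, Finset.mem_univ _, ?_⟩
  rw [← Finset.sdiff_union_of_subset heT, hx]
  rfl

/-- Only triangles that meet `T` contribute to the variance: at most `3 m` of them share a vertex
with `T`, and at most `3 n` an edge. -/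
theorem sum_pow_card_union_le {p : ℝ} (hp0 : 0 ≤ p) {T : Finset (Fin n)}
    (hT : T ∈ G.cliqueFinset 3) :
    ∑ T' ∈ G.cliqueFinset 3, (p ^ (T ∪ T').card - p ^ 6) ≤
      3 * numEdges G * p ^ 5 + 3 * n * p ^ 4 + p ^ 3 := by
  have h3 : ∀ T ∈ G.cliqueFinset 3, T.card = 3 := fun T hT =>
    (SimpleGraph.mem_cliqueFinset_iff.1 hT).card_eq
  have key : ∀ T' ∈ G.cliqueFinset 3, p ^ (T ∪ T').card - p ^ 6 ≤
      (∑ v ∈ T, if v ∈ T' then p ^ 5 else 0) +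
        (∑ e ∈ T.powersetCard 2, if e ⊆ T' then p ^ 4 else 0) + if T = T' then p ^ 3 else 0 := by
    intro T' hT'
    have hcard := Finset.card_union_add_card_inter T T'
    rw [h3 T hT, h3 T' hT'] at hcard
    have hle : (T ∩ T').card ≤ 3 := (Finset.card_le_card Finset.inter_subset_left).trans_eq (h3 T hT)
    have s1 : ∑ v ∈ T, (if v ∈ T' then p ^ 5 else 0) = (T ∩ T').card * p ^ 5 := by
      rw [← Finset.sum_filter, Finset.filter_mem_eq_inter]
      simp
    have s2 : 0 ≤ ∑ e ∈ T.powersetCard 2, if e ⊆ T' then p ^ 4 else 0 :=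
      Finset.sum_nonneg fun e _ => by positivity
    have s3 : 0 ≤ if T = T' then p ^ 3 else 0 := by positivity
    have hp5 : 0 ≤ p ^ 5 := by positivity
    have hp6 : 0 ≤ p ^ 6 := by positivity
    rw [s1]
    interval_cases hi : (T ∩ T').card
    · rw [show (T ∪ T').card = 6 by omega]
      push_cast
      linarith
    · rw [show (T ∪ T').card = 5 by omega]
      push_cast
      linarith
    · rw [show (T ∪ T').card = 4 by omega]
      have : p ^ 4 ≤ ∑ e ∈ T.powersetCard 2, if e ⊆ T' then p ^ 4 else 0 := by
        have hmem : T ∩ T' ∈ T.powersetCard 2 :=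
          Finset.mem_powersetCard.2 ⟨Finset.inter_subset_left, hi⟩
        refine le_trans ?_ (Finset.single_le_sum (fun e _ => by positivity) hmem)
        rw [if_pos Finset.inter_subset_right]
      push_cast
      linarith
    · have hTT : T = T' := by
        have e1 := Finset.eq_of_subset_of_card_le (Finset.inter_subset_left (s₁ := T) (s₂ := T'))
          (by rw [hi, h3 T hT])
        have e2 := Finset.eq_of_subset_of_card_le (Finset.inter_subset_right (s₁ := T) (s₂ := T'))
          (by rw [hi, h3 T' hT'])
        rw [← e1, e2]
      rw [show (T ∪ T').card = 3 by omega, if_pos hTT]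
      push_cast
      linarith
  refine (Finset.sum_le_sum key).trans ?_
  rw [Finset.sum_add_distrib, Finset.sum_add_distrib]
  gcongr ?_ + ?_ + ?_
  · rw [Finset.sum_comm]
    calc ∑ v ∈ T, ∑ T' ∈ G.cliqueFinset 3, (if v ∈ T' then p ^ 5 else 0)
        ≤ ∑ v ∈ T, numEdges G * p ^ 5 := by
          refine Finset.sum_le_sum fun v _ => ?_
          rw [← Finset.sum_filter, Finset.sum_const, nsmul_eq_mul]
          gcongr
          exact card_triangles_mem_le G v
      _ = _ := by
          rw [Finset.sum_const, h3 T hT, nsmul_eq_mul]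
          push_cast
          ring
  · rw [Finset.sum_comm]
    calc ∑ e ∈ T.powersetCard 2, ∑ T' ∈ G.cliqueFinset 3, (if e ⊆ T' then p ^ 4 else 0)
        ≤ ∑ e ∈ T.powersetCard 2, n * p ^ 4 := by
          refine Finset.sum_le_sum fun e he => ?_
          rw [← Finset.sum_filter, Finset.sum_const, nsmul_eq_mul]
          gcongr
          exact card_triangles_superset_le G e (Finset.mem_powersetCard.1 he).2
      _ = _ := by
          rw [Finset.sum_const, Finset.card_powersetCard, h3 T hT, nsmul_eq_mul]
          norm_num [Nat.choose]
          ring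
  · rw [Finset.sum_ite_eq, if_pos hT]

/-- Chebyshev's inequality for the vertex-sampling estimator with sampling probability `1 / q`. -/
theorem sampleProb_ge {q : ℝ} (hq : 1 ≤ q) (ht : 0 < numTriangles G) {ε : ℝ} (hε : 0 < ε) :
    1 - q * (3 * numEdges G + 3 * n * q + q ^ 2) / (ε ^ 2 * numTriangles G) ≤
      sampleProb n q⁻¹ fun U => (numTrianglesIn G U : ℝ) * q ^ 3 ∈
        Set.Icc ((1 - ε) * (numTriangles G : ℝ)) ((1 + ε) * (numTriangles G : ℝ)) := by
  classical
  have hq0 : 0 < q := by linarith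
  set p := q⁻¹ with hp
  have hp0 : 0 < p := by positivity
  have hp1 : p ≤ 1 := inv_le_one_of_one_le₀ hq
  have hqp : q * p = 1 := mul_inv_cancel₀ hq0.ne'
  set t : ℝ := (numTriangles G : ℝ) with htt
  have ht' : 0 < t := Nat.cast_pos.2 ht
  set W : Finset (Fin n) → ℝ := fun U => p ^ U.card * (1 - p) ^ (n - U.card) with hW
  have hW0 : ∀ U, 0 ≤ W U := fun U =>
    mul_nonneg (by positivity) (pow_nonneg (by linarith) _)
  set V : ℝ := 3 * numEdges G * p ^ 5 + 3 * n * p ^ 4 + p ^ 3 with hV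
  have hvar : ∑ U, W U * ((numTrianglesIn G U : ℝ) - t * p ^ 3) ^ 2 ≤ t * V := by
    have := sum_weight_sq p (G.cliqueFinset 3) fun T hT =>
      (SimpleGraph.mem_cliqueFinset_iff.1 hT).card_eq
    refine (Eq.trans ?_ this).trans_le ?_
    · rfl
    · refine (Finset.sum_le_sum fun T hT => sum_pow_card_union_le G hp0.le hT).trans_eq ?_
      rw [Finset.sum_const, nsmul_eq_mul, htt, hV, numTriangles]
  set Q : Finset (Fin n) → Prop := fun U => (numTrianglesIn G U : ℝ) * q ^ 3 ∈
    Set.Icc ((1 - ε) * t) ((1 + ε) * t) with hQ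
  have hsplit : sampleProb n p Q = 1 - ∑ U ∈ Finset.univ.filter (fun U => ¬ Q U), W U := by
    exact sampleProb_eq_one_sub p Q
  rw [hsplit]
  gcongr
  have hbad : ∀ U, ¬ Q U → (ε * t * p ^ 3) ^ 2 ≤ ((numTrianglesIn G U : ℝ) - t * p ^ 3) ^ 2 := by
    intro U hU
    rw [sq_le_sq, abs_of_pos (by positivity)]
    by_contra! h
    rw [abs_lt] at h
    apply hU
    have e : ∀ y : ℝ, y = y * p ^ 3 * q ^ 3 := fun y => by
      rw [mul_assoc, ← mul_pow, mul_comm p, hqp]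
      simp
    rw [hQ]
    constructor
    · rw [e ((1 - ε) * t)]
      gcongr
      linarith [h.1]
    · rw [e ((1 + ε) * t)]
      gcongr
      linarith [h.2]
  have hc : 0 < (ε * t * p ^ 3) ^ 2 := by positivity
  calc ∑ U ∈ Finset.univ.filter (fun U => ¬ Q U), W U
      ≤ ∑ U ∈ Finset.univ.filter (fun U => ¬ Q U),
          W U * ((numTrianglesIn G U : ℝ) - t * p ^ 3) ^ 2 / (ε * t * p ^ 3) ^ 2 := by
        refine Finset.sum_le_sum fun U hU => ?_
        rw [le_div_iff₀ hc]
        exact mul_le_mul_of_nonneg_left (hbad U (Finset.mem_filter.1 hU).2) (hW0 U)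
    _ ≤ ∑ U, W U * ((numTrianglesIn G U : ℝ) - t * p ^ 3) ^ 2 / (ε * t * p ^ 3) ^ 2 :=
        Finset.sum_le_sum_of_subset_of_nonneg (Finset.subset_univ _) fun U _ _ =>
          div_nonneg (mul_nonneg (hW0 U) (sq_nonneg _)) hc.le
    _ ≤ t * V / (ε * t * p ^ 3) ^ 2 := by
        rw [← Finset.sum_div]
        gcongr
    _ = _ := by
        rw [hV, hp]
        field_simp

end Sampling

/-! ### Both parts together -/

theorem theorem3 (δ ω : ℝ) (hδ0 : 0 < δ) (hδ : δ ≤ 1 / 4) (hω : WordRAM.MatMulInTime ω) :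
    -- the vertex-sampling estimator
    (∀ c₁ c₂ : ℝ, 0 < c₁ → 0 < c₂ → ∃ C : ℝ, 0 < C ∧
      ∀ n : ℕ, 1 ≤ n → ∀ (G : SimpleGraph (Fin n)) [DecidableRel G.Adj],
        c₁ * (n : ℝ) ^ (1 + 3.82 * δ) ≤ (numEdges G : ℝ) →
        c₂ * (numEdges G : ℝ) ^ (1 + δ) ≤ (numTriangles G : ℝ) →
        ∀ ε : ℝ, 0 < ε → ε ≤ 1 / 2 →
          1 - C * ε ^ (-2 : ℤ) * (n : ℝ) ^ (-(3.82 * δ ^ 2)) ≤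
            sampleProb n ((n : ℝ) ^ (-δ)) fun U =>
              (numTrianglesIn G U : ℝ) * (n : ℝ) ^ (3 * δ) ∈
                Set.Icc ((1 - ε) * (numTriangles G : ℝ)) ((1 + ε) * (numTriangles G : ℝ))) ∧
    -- a randomized algorithm for either of the two time bounds
    ∀ T : ℕ → ℕ → ℝ,
      (T = (fun (n _ : ℕ) => (n : ℝ) ^ (ω * (1 - δ))) ∨
        T = (fun (n m : ℕ) => ((m : ℝ) * (n : ℝ) ^ (-2 * δ)) ^ (2 * ω / (ω + 1)))) →
      ∃ (P : WordRAM.Cmd) (κ : ℕ) (γ : ℝ), 0 < γ ∧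
        ∀ c₁ c₂ : ℝ, 0 < c₁ → 0 < c₂ → ∃ C : ℝ, 0 < C ∧
          ∀ n : ℕ, 1 ≤ n → ∀ (G : SimpleGraph (Fin n)) [DecidableRel G.Adj]
            (nbr : (u : Fin n) → Fin (G.degree u) ≃ G.neighborSet u),
            c₁ * (n : ℝ) ^ (1 + 3.82 * δ) ≤ (numEdges G : ℝ) →
            c₂ * (numEdges G : ℝ) ^ (1 + δ) ≤ (numTriangles G : ℝ) →
            ∀ w : ℕ, (n + 2) ^ κ ≤ 2 ^ w →
              WordRAM.expectedTime w P (WordRAM.graphInput G nbr) ≤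
                ENNReal.ofReal (C * T n (numEdges G)) ∧
              ∀ ε : ℝ, 0 < ε → ε ≤ 1 / 2 →
                1 - C * ε ^ (-2 : ℤ) * (n : ℝ) ^ (-γ) ≤
                  WordRAM.successProb w P (WordRAM.graphInput G nbr) (GoodOutput G ε) := by
  refine ⟨fun c₁ c₂ hc₁ hc₂ => ?_, fun T hT => ?_⟩
  · refine ⟨(3 + 4 / c₁) * (c₂ * c₁ ^ δ)⁻¹, by positivity, fun n hn G _ hm ht ε hε _ => ?_⟩
    have hn' : (1 : ℝ) ≤ n := by exact_mod_cast hn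
    have hn0 : (0 : ℝ) < n := by linarith
    obtain ⟨hm0, ht0, hmt⟩ := WordRAM.edges_div_triangles_le hδ0 hc₁ hc₂ hn' hm ht
    set m : ℝ := (numEdges G : ℝ)
    set t : ℝ := (numTriangles G : ℝ)
    have hq : 1 ≤ (n : ℝ) ^ δ := Real.one_le_rpow hn' hδ0.le
    have h := sampleProb_ge G hq (Nat.cast_pos.1 ht0) hε
    rw [Real.rpow_neg hn0.le δ, show (n : ℝ) ^ (3 * δ) = ((n : ℝ) ^ δ) ^ 3 by
      rw [← Real.rpow_natCast, ← Real.rpow_mul hn0.le, mul_comm]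
      norm_num]
    refine le_trans (sub_le_sub_left ?_ 1) h
    have hnm : (n : ℝ) ^ (1 + 3.82 * δ) ≤ m / c₁ := by
      rw [le_div_iff₀ hc₁, mul_comm]
      exact hm
    have h1 : (n : ℝ) * (n : ℝ) ^ δ ≤ m / c₁ := by
      refine le_trans ?_ hnm
      rw [← Real.rpow_one_add' hn0.le (by linarith)]
      exact Real.rpow_le_rpow_of_exponent_le hn' (by linarith)
    have h2 : ((n : ℝ) ^ δ) ^ 2 ≤ m / c₁ := by
      refine le_trans ?_ hnm
      rw [← Real.rpow_natCast, ← Real.rpow_mul hn0.le]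
      exact Real.rpow_le_rpow_of_exponent_le hn' (by push_cast; linarith)
    calc (n : ℝ) ^ δ * (3 * m + 3 * n * (n : ℝ) ^ δ + ((n : ℝ) ^ δ) ^ 2) / (ε ^ 2 * t)
        ≤ (n : ℝ) ^ δ * (3 * m + 4 * (m / c₁)) / (ε ^ 2 * t) := by
          refine div_le_div_of_nonneg_right (mul_le_mul_of_nonneg_left ?_ (by positivity))
            (by positivity)
          linarith
      _ = (3 + 4 / c₁) * ε ^ (-2 : ℤ) * ((n : ℝ) ^ δ * (m / t)) := by
          rw [zpow_neg, zpow_ofNat]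
          field_simp
      _ ≤ (3 + 4 / c₁) * ε ^ (-2 : ℤ) *
            ((n : ℝ) ^ δ * ((c₂ * c₁ ^ δ)⁻¹ * (n : ℝ) ^ (-((1 + 3.82 * δ) * δ)))) := by
          gcongr
      _ = _ := by
          rw [show -(3.82 * δ ^ 2) = δ + -((1 + 3.82 * δ) * δ) by ring, Real.rpow_add hn0]
          ring
  · refine ⟨WordRAM.mainProg, 6, δ, hδ0, fun c₁ c₂ hc₁ hc₂ => ?_⟩
    obtain ⟨K, hK0, hK⟩ := WordRAM.linear_le_time hδ0 hδ hω.two_le hc₁ hT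
    refine ⟨300 * K + (2 / c₁ + 8) * (c₂ * c₁ ^ δ)⁻¹, by positivity,
      fun n hn G _ nbr hm ht w hw => ⟨?_, fun ε hε hε' => ?_⟩⟩
    · refine (WordRAM.mainProg_expectedTime G nbr hn hw).trans (ENNReal.ofReal_le_ofReal ?_)
      have h1 := hK n (numEdges G) hn hm
      have hn0 : (0 : ℝ) < n := by exact_mod_cast hn
      have hT0 : 0 < T n (numEdges G) := pos_of_mul_pos_right (hn0.trans_le h1) hK0.le
      have h2 : 0 < (2 / c₁ + 8) * (c₂ * c₁ ^ δ)⁻¹ * T n (numEdges G) := by positivity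
      linarith
    · have hn' : (1 : ℝ) ≤ n := by exact_mod_cast hn
      have hn0 : (0 : ℝ) < n := by linarith
      have hm1 : c₁ * (n : ℝ) ^ (1 : ℝ) ≤ numEdges G := le_trans
        (mul_le_mul_of_nonneg_left (Real.rpow_le_rpow_of_exponent_le hn' (by linarith)) hc₁.le) hm
      obtain ⟨hm0, ht0, hmt⟩ := WordRAM.edges_div_triangles_le hδ0 hc₁ hc₂ hn' hm1 ht
      refine le_trans (sub_le_sub_left ?_ 1)
        (WordRAM.mainProg_successProb G nbr hn hw (by exact_mod_cast ht0) hε (by linarith))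
      set m : ℝ := (numEdges G : ℝ)
      set t : ℝ := (numTriangles G : ℝ)
      have h1 : (n : ℝ) ≤ m / c₁ := by
        rw [le_div_iff₀ hc₁, mul_comm]
        simpa using hm1
      calc (2 * n + 8 * m : ℝ) / (ε ^ 2 * t) ≤ (2 * (m / c₁) + 8 * m) / (ε ^ 2 * t) := by gcongr
        _ = (2 / c₁ + 8) * ε ^ (-2 : ℤ) * (m / t) := by
          rw [zpow_neg, zpow_ofNat]
          field_simp
        _ ≤ (2 / c₁ + 8) * ε ^ (-2 : ℤ) * ((c₂ * c₁ ^ δ)⁻¹ * (n : ℝ) ^ (-(1 * δ))) := by gcongr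
        _ = (2 / c₁ + 8) * (c₂ * c₁ ^ δ)⁻¹ * ε ^ (-2 : ℤ) * (n : ℝ) ^ (-δ) := by
          rw [one_mul]
          ring
        _ ≤ _ := by
          gcongr
          have : 0 < 300 * K := by positivity
          linarith
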